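/- Let $d\ge 1$ and $n>3$ be integers, let $\mu$ be a Borel measure on $\mathbb{R}^d$ with $\mu([0,1]^d)=1$, and put $A=[0,1]^{2d}=[0,1]^d\times[0,1]^d$. Let $(X_i)_{i\ge 0}$ be a time-homogeneous Markov chain on a probability space, with values in $\mathbb{R}^d$ and transition density $s$ with respect to $\mu$: $s\ge 0$ is measurable on $\mathbb{R}^d\times\mathbb{R}^d$, $\int s(x,y)\,d\mu(y)=1$ for every $x$, and conditionally on $X_0,\dots,X_i$ the law of $X_{i+1}$ is $s(X_i,y)\,d\mu(y)$. Nothing else is assumed on the chain. For nonnegative functions $f,f'$ on $\mathbb{R}^{2d}$ set $$H^2(f,f')=\frac1{2n}\sum_{i=0}^{n-1}\int\Big(\sqrt{f(X_i,y)}-\sqrt{f'(X_i,y)}\Big)^2d\mu(y),$$ $$T(f,f')=\frac{1}{2n\sqrt2}\sum_{i=0}^{n-1}\int\sqrt{f(X_i,y)+f'(X_i,y)}\Big(\sqrt{f'(X_i,y)}-\sqrt{f(X_i,y)}\Big)d\mu(y)+\frac1{n\sqrt2}\sum_{i=0}^{n-1}\frac{\sqrt{f'(X_i,X_{i+1})}-\sqrt{f(X_i,X_{i+1})}}{\sqrt{f(X_i,X_{i+1})+f'(X_i,X_{i+1})}}+\frac1{2n}\sum_{i=0}^{n-1}\int\big(f(X_i,y)-f'(X_i,y)\big)d\mu(y),$$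 with $0/0=0$, and let $H^2(f,V)=\inf_{g\in V}H^2(f,g)$ for a set $V$ of such functions. For $j\ge0$ let $\mathcal K_j$ be the set of the $4^{jd}$ dyadic cubes $\prod_{i=1}^{2d}I_j(l_i)$, $1\le l_i\le 2^j$, where $I_j(l)=[\frac{l-1}{2^j},\frac{l}{2^j})$ if $l<2^j$ and $I_j(2^j)=[1-2^{-j},1]$. For $\ell\in\mathbb{N}^\star$ let $\mathcal M_\ell$ be the set of all partitions of $A$ that are obtained from $\{A\}$ in at most $\ell$ steps, where one step replaces some (possibly none) of the cubes $K\in\mathcal K_j$ of the current partition by the $4^d$ cubes of $\mathcal K_{j+1}$ contained in $K$; let $\mathcal M_\infty=\bigcup_{\ell\ge1}\mathcal M_\ell$. For $m\in\mathcal M_\infty$ let $V_m=\{\sum_{K\in m}a_K\mathbf 1_K:\ a_K\ge 0\}$ and $$\hat s_m=\sum_{K\in m}\frac{\sum_{i=0}^{n-1}\mathbf 1_K(X_i,X_{i+1})}{\sum_{i=0}^{n-1}\int_{[0,1]^d}\mathbf 1_K(X_i,x)\,d\mu(x)}\,\mathbf 1_K ,$$ a quotient with denominator $0$ being $0$. For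 a set $K$ let $m\vee K=\{K'\cap K:\ K'\in m,\ K'\cap K\ne\emptyset\}$. For $L>0$ and a finite collection $m$ of sets let $\mathrm{pen}(m)=L|m|\log n/n$. Let $\alpha=(1-1/\sqrt2)/2$. For $L>0$, $\ell\in\mathbb{N}^\star\cup\{\infty\}$ and $m\in\mathcal M_\ell$ put $$\gamma(m)=\sum_{K\in m}\ \sup_{m'\in\mathcal M_\ell}\Big[\sum_{K'\in m'}\Big(\alpha H^2(\hat s_m\mathbf 1_{K\cap K'},\hat s_{m'}\mathbf 1_{K\cap K'})+T(\hat s_m\mathbf 1_{K\cap K'},\hat s_{m'}\mathbf 1_{K\cap K'})\Big)-\mathrm{pen}(m'\vee K)\Big]+2\,\mathrm{pen}(m),$$ let $\hat m$ be any (measurable) random element of $\mathcal M_\ell$ with $\gamma(\hat m)\le\inf_{m\in\mathcal M_\ell}\gamma(m)+1/n$, and let $\hat s=\hat s(L,\ell)=\hat s_{\hat m}$. Theorem. There are universal constants $L_0>0$ and $C>0$ (depending on none of the quantities above) such that, in the above setting, for all $L\ge L_0$, all $\ell\in\mathbb{N}^\star\cup\{\infty\}$ and every such choice of $\hat m$,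 the loss $H^2(s\mathbf 1_A,\hat s)$ is integrable and $$C\,\mathbb E\big[H^2(s\mathbf 1_A,\hat s)\big]\le\inf_{m\in\mathcal M_\ell}\Big\{\mathbb E\big[H^2(s\mathbf 1_A,V_m)\big]+\mathrm{pen}(m)\Big\}.$$ -/

import Mathlib

open MeasureTheory

noncomputable section

namespace TransitionDensity

/-- `ℝ^{2d}`, written as `ℝ^d × ℝ^d`: the first factor carries the current state of the chain,
the second one the next state. -/
abbrev Pair (d : ℕ) : Type := (Fin d → ℝ) × (Fin d → ℝ)

/-- The cube `[0,1]^d`. -/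
def unitCube (d : ℕ) : Set (Fin d → ℝ) := Set.Icc 0 1

/-- The set `A = [0,1]^{2d}`. -/
def unitSquare (d : ℕ) : Set (Pair d) := unitCube d ×ˢ unitCube d

/-- `(X i)` is a time-homogeneous Markov chain with values in `ℝ^d` whose transition density with
respect to `μ` is `s`: conditionally on `X 0, …, X i`, the law of `X (i+1)` is
`s (X i, y) μ(dy)`. -/
structure IsMarkovChain {Ω : Type*} [MeasurableSpace Ω] (P : Measure Ω) {d : ℕ}
    (μ : Measure (Fin d → ℝ)) (s : Pair d → ℝ) (X : ℕ → Ω → (Fin d → ℝ)) : Prop where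
  measurable_chain : ∀ i, Measurable (X i)
  measurable_density : Measurable s
  density_nonneg : ∀ p, 0 ≤ s p
  lintegral_density : ∀ x, ∫⁻ y, ENNReal.ofReal (s (x, y)) ∂μ = 1
  markov : ∀ (i : ℕ) (B : Set (Fin d → ℝ)), MeasurableSet B →
    P[(X (i + 1) ⁻¹' B).indicator (fun _ => (1 : ℝ)) |
        ⨆ (j : ℕ) (_ : j ≤ i), MeasurableSpace.comap (X j) inferInstance]
      =ᵐ[P] fun ω => ∫ y in B, s (X i ω, y) ∂μ

/-! ### Dyadic partitions of `[0,1]^{2d}` -/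

/-- The interval `I_j(l)`, for `1 ≤ l ≤ 2^j`. -/
def dyadicInterval (j l : ℕ) : Set ℝ :=
  if l < 2 ^ j then Set.Ico (((l : ℝ) - 1) / 2 ^ j) ((l : ℝ) / 2 ^ j)
  else Set.Icc (((l : ℝ) - 1) / 2 ^ j) 1

/-- The cube `K_{j,l} = ∏ I_j(l_i)`; the `2d` coordinates are indexed by `Fin d ⊕ Fin d`. -/
def dyadicCube {d : ℕ} (j : ℕ) (l : Fin d ⊕ Fin d → ℕ) : Set (Pair d) :=
  {p | (∀ i, p.1 i ∈ dyadicInterval j (l (Sum.inl i))) ∧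
    ∀ i, p.2 i ∈ dyadicInterval j (l (Sum.inr i))}

open Classical in
/-- The collection `𝒦_j` of all dyadic cubes of side length `2^{-j}`. -/
def dyadicCubes (d j : ℕ) : Finset (Set (Pair d)) :=
  (Fintype.piFinset fun _ : Fin d ⊕ Fin d => Finset.Icc 1 (2 ^ j)).image (dyadicCube j)

open Classical in
/-- One step of the algorithm: some of the cubes of `m` (those in `D`) are divided, a cube of
`𝒦_j` being divided into the elements of `𝒦_{j+1}` that it contains. -/
def IsStep {d : ℕ} (m m' : Finset (Set (Pair d))) : Prop :=
  ∃ D ⊆ m, ∃ j : Set (Pair d) → ℕ, (∀ K ∈ D, K ∈ dyadicCubes d (j K)) ∧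
    m' = (m \ D) ∪ D.biUnion fun K => (dyadicCubes d (j K + 1)).filter fun K' => K' ⊆ K

/-- The partitions obtained after `k` steps of the algorithm. As a step may divide nothing,
these are those that can be constructed in at most `k` steps. -/
def partitionsAfter (d : ℕ) : ℕ → Set (Finset (Set (Pair d)))
  | 0 => {{unitSquare d}}
  | k + 1 => {m' | ∃ m ∈ partitionsAfter d k, IsStep m m'}

/-- The collection `𝓜_ℓ`, for `ℓ` finite or infinite. -/
def partitions (d : ℕ) (ℓ : ℕ∞) : Set (Finset (Set (Pair d))) :=
  {m | ∃ k : ℕ, (k : ℕ∞) ≤ ℓ ∧ m ∈ partitionsAfter d k}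

open Classical in
/-- The partition `m' ∨ K` of `K`. -/
def join {d : ℕ} (m' : Finset (Set (Pair d))) (K : Set (Pair d)) : Finset (Set (Pair d)) :=
  (m'.filter fun K' => (K' ∩ K).Nonempty).image fun K' => K' ∩ K

/-! ### Loss, estimators and selection rule, as functions of the observed path `x` -/

/-- The squared random Hellinger distance `H²(f, g)`. -/
def hellingerSq {d : ℕ} (μ : Measure (Fin d → ℝ)) (n : ℕ) (x : ℕ → (Fin d → ℝ))
    (f g : Pair d → ℝ) : ℝ :=
  1 / (2 * (n : ℝ)) *
    ∑ i ∈ Finset.range n, ∫ y, (Real.sqrt (f (x i, y)) - Real.sqrt (g (x i, y))) ^ 2 ∂μ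

/-- The set `V_m` of nonnegative functions that are piecewise constant on `m`. -/
def histograms {d : ℕ} (m : Finset (Set (Pair d))) : Set (Pair d → ℝ) :=
  {f | ∃ a : Set (Pair d) → ℝ, (∀ K ∈ m, 0 ≤ a K) ∧
    f = fun p => ∑ K ∈ m, a K * K.indicator (fun _ => (1 : ℝ)) p}

/-- `H²(f, V) = inf_{g ∈ V} H²(f, g)`. -/
def hellingerSqDist {d : ℕ} (μ : Measure (Fin d → ℝ)) (n : ℕ) (x : ℕ → (Fin d → ℝ))
    (f : Pair d → ℝ) (V : Set (Pair d → ℝ)) : ℝ :=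
  ⨅ g : V, hellingerSq μ n x f g

/-- The histogram estimator `ŝ_m` (with `a / 0 = 0`). -/
def histogramEstimator {d : ℕ} (μ : Measure (Fin d → ℝ)) (n : ℕ) (x : ℕ → (Fin d → ℝ))
    (m : Finset (Set (Pair d))) : Pair d → ℝ := fun p =>
  ∑ K ∈ m,
    (∑ i ∈ Finset.range n, K.indicator (fun _ => (1 : ℝ)) (x i, x (i + 1))) /
      (∑ i ∈ Finset.range n, ∫ y in unitCube d, K.indicator (fun _ => (1 : ℝ)) (x i, y) ∂μ) *
      K.indicator (fun _ => (1 : ℝ)) p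

/-- The test functional `T(f, g)` (with `0 / 0 = 0`). -/
def testT {d : ℕ} (μ : Measure (Fin d → ℝ)) (n : ℕ) (x : ℕ → (Fin d → ℝ))
    (f g : Pair d → ℝ) : ℝ :=
  1 / (2 * (n : ℝ) * Real.sqrt 2) *
      ∑ i ∈ Finset.range n, ∫ y, Real.sqrt (f (x i, y) + g (x i, y)) *
        (Real.sqrt (g (x i, y)) - Real.sqrt (f (x i, y))) ∂μ
    + 1 / ((n : ℝ) * Real.sqrt 2) *
      ∑ i ∈ Finset.range n,
        (Real.sqrt (g (x i, x (i + 1))) - Real.sqrt (f (x i, x (i + 1)))) /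
          Real.sqrt (f (x i, x (i + 1)) + g (x i, x (i + 1)))
    + 1 / (2 * (n : ℝ)) *
      ∑ i ∈ Finset.range n, ∫ y, (f (x i, y) - g (x i, y)) ∂μ

/-- The penalty `pen(m) = L |m| log n / n`. -/
def pen {d : ℕ} (L : ℝ) (n : ℕ) (m : Finset (Set (Pair d))) : ℝ :=
  L * ((m.card : ℝ) * Real.log n / n)

/-- The constant `α = (1 - 1/√2)/2`. -/
def alpha : ℝ := (1 - 1 / Real.sqrt 2) / 2

/-- The criterion `γ(m)`. -/
def criterion {d : ℕ} (μ : Measure (Fin d → ℝ)) (n : ℕ) (L : ℝ) (ℓ : ℕ∞)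
    (x : ℕ → (Fin d → ℝ)) (m : Finset (Set (Pair d))) : ℝ :=
  (∑ K ∈ m, ⨆ m' : partitions d ℓ,
    ((∑ K' ∈ m'.1,
        (alpha * hellingerSq μ n x
            ((K ∩ K').indicator (histogramEstimator μ n x m))
            ((K ∩ K').indicator (histogramEstimator μ n x m'.1))
          + testT μ n x
            ((K ∩ K').indicator (histogramEstimator μ n x m))
            ((K ∩ K').indicator (histogramEstimator μ n x m'.1))))
      - pen L n (join m'.1 K)))
    + 2 * pen L n m

/-- The random partition `mhat` is an admissible choice of `m̂` in `𝓜_ℓ` based on the observations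
`X 0, …, X n`. -/
structure IsSelected {Ω : Type*} [MeasurableSpace Ω] {d : ℕ} (μ : Measure (Fin d → ℝ)) (n : ℕ)
    (L : ℝ) (ℓ : ℕ∞) (X : ℕ → Ω → (Fin d → ℝ)) (mhat : Ω → Finset (Set (Pair d))) : Prop where
  mem : ∀ ω, mhat ω ∈ partitions d ℓ
  measurableSet_eq : ∀ m ∈ partitions d ℓ, MeasurableSet {ω | mhat ω = m}
  criterion_le : ∀ ω, criterion μ n L ℓ (fun i => X i ω) (mhat ω) ≤
    (⨅ m : partitions d ℓ, criterion μ n L ℓ (fun i => X i ω) m.1) + 1 / (n : ℝ)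

end TransitionDensity

end

/-!
For a dyadic cube `K`, write `N(K)` for the number of transitions `(X i, X (i + 1))` in `K`, `D(K)`
for the occupation time `∑ i, ∫ 𝟙_K (X i, y) μ(dy)` and `S(K) = ∑ i, ∫_K s (X i, y) μ(dy)` for the
compensator of `N(K)`. Two nonempty intersecting dyadic cubes are nested, so on `K ∩ K'` the
histograms of two partitions are constants `a` and `b`, and `n (α H² + T)` is an affine function of
`D(K ∩ K')` and `N(K ∩ K')`. If `N` is replaced by `S`, this function is at most twice the loss of
`a` minus a fraction of the loss of `b`; the error made by this replacement is of the order of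
`(√N - √S)²`.

An exponential supermartingale shows that `(√N - √S)² ≤ 36 log n` simultaneously for all cubes of
level at most `2 n`, outside an event of probability at most `36 / n`. There are exponentially many
such cubes, but the failure probability of each is proportional to `𝔼 S(K)`, and these expectations
add up to at most `n` on each level. Deeper cubes never matter: a cube `b` levels below `K` forces
at least `b` elements of `m' ∨ K`, and for `|m' ∨ K| > n` the penalty alone exceeds the score.

On the good event, `γ(m)` is therefore at most a multiple of the loss of `ŝ_m` plus `2 pen(m)`. The
test is antisymmetric up to the nonnegative term `α H²`, so comparing `m̂` with `m` bounds `γ(m̂)`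
from below by a fraction of the loss of `ŝ_m̂` minus the loss of `ŝ_m` and `pen(m)`, and the
selection rule yields the oracle inequality. Off the good event the loss is at most `1`, and the
event itself is negligible in front of `pen(m)`.
-/

noncomputable section

namespace TransitionDensity

/-! ### Dyadic cubes -/

section Dyadic

/-- The label `l` of the dyadic interval of level `j` that contains `t ∈ [0,1]`. -/
def dyadicIndex (j : ℕ) (t : ℝ) : ℕ := min (⌊t * 2 ^ j⌋₊ + 1) (2 ^ j)

lemma one_le_dyadicIndex (j : ℕ) (t : ℝ) : 1 ≤ dyadicIndex j t :=
  le_min (Nat.le_add_left _ _) Nat.one_le_two_pow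

lemma dyadicIndex_le (j : ℕ) (t : ℝ) : dyadicIndex j t ≤ 2 ^ j := min_le_right _ _

lemma dyadicInterval_subset_Icc {j l : ℕ} (h1 : 1 ≤ l) : dyadicInterval j l ⊆ Set.Icc 0 1 := by
  have hl : (0 : ℝ) ≤ ((l : ℝ) - 1) / 2 ^ j := by
    have : (1 : ℝ) ≤ l := by exact_mod_cast h1
    exact div_nonneg (by linarith) (by positivity)
  unfold dyadicInterval
  split_ifs with h
  · have hl1 : (l : ℝ) / 2 ^ j ≤ 1 := by
      rw [div_le_one (by positivity)]
      exact_mod_cast h.le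
    exact fun t ht => ⟨hl.trans ht.1, ht.2.le.trans hl1⟩
  · exact Set.Icc_subset_Icc_left hl

lemma mem_dyadicInterval_iff_dyadicIndex_eq {j l : ℕ} (h1 : 1 ≤ l) (h2 : l ≤ 2 ^ j) {t : ℝ}
    (ht : t ∈ Set.Icc (0 : ℝ) 1) : t ∈ dyadicInterval j l ↔ dyadicIndex j t = l := by
  obtain ⟨k, rfl⟩ : ∃ k, l = k + 1 := ⟨l - 1, by omega⟩
  have hp : (0 : ℝ) < 2 ^ j := by positivity
  have hfloor : ((k + 1 : ℕ) - 1 : ℝ) / 2 ^ j ≤ t ↔ k ≤ ⌊t * 2 ^ j⌋₊ := by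
    rw [Nat.le_floor_iff (mul_nonneg ht.1 hp.le), div_le_iff₀ hp]
    push_cast
    rw [add_sub_cancel_right]
  unfold dyadicInterval dyadicIndex
  split_ifs with h
  · rw [Set.mem_Ico, hfloor, lt_div_iff₀ hp, ← Nat.floor_lt (mul_nonneg ht.1 hp.le)]
    omega
  · rw [Set.mem_Icc, hfloor, and_iff_left ht.2]
    omega

lemma mem_dyadicInterval_iff {j l : ℕ} (h1 : 1 ≤ l) (h2 : l ≤ 2 ^ j) {t : ℝ} :
    t ∈ dyadicInterval j l ↔ t ∈ Set.Icc (0 : ℝ) 1 ∧ dyadicIndex j t = l := by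
  constructor
  · intro ht
    have ht' := dyadicInterval_subset_Icc h1 ht
    exact ⟨ht', (mem_dyadicInterval_iff_dyadicIndex_eq h1 h2 ht').mp ht⟩
  · rintro ⟨ht', ht⟩
    exact (mem_dyadicInterval_iff_dyadicIndex_eq h1 h2 ht').mpr ht

lemma dyadicIndex_eq_half (j : ℕ) (t : ℝ) :
    dyadicIndex j t = (dyadicIndex (j + 1) t + 1) / 2 := by
  have hfloor : ⌊t * 2 ^ j⌋₊ = ⌊t * 2 ^ (j + 1)⌋₊ / 2 := by
    rw [← Nat.floor_div_ofNat, pow_succ]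
    congr 1
    simp only [OfNat.ofNat]
    ring
  unfold dyadicIndex
  rw [hfloor, pow_succ]
  omega

lemma dyadicIndex_eq_of_le {i j : ℕ} (hij : i ≤ j) {t u : ℝ}
    (h : dyadicIndex j t = dyadicIndex j u) : dyadicIndex i t = dyadicIndex i u := by
  induction j, hij using Nat.le_induction with
  | base => exact h
  | succ j _ ih => exact ih (by rw [dyadicIndex_eq_half j t, dyadicIndex_eq_half j u, h])

lemma exists_dyadicIndex_eq {j l : ℕ} (h1 : 1 ≤ l) (h2 : l ≤ 2 ^ j) :
    ∃ t ∈ Set.Icc (0 : ℝ) 1, dyadicIndex j t = l := by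
  have hl : (l : ℝ) ≤ 2 ^ j := by exact_mod_cast h2
  refine ⟨((l : ℝ) - 1) / 2 ^ j, (mem_dyadicInterval_iff h1 h2).mp ?_⟩
  unfold dyadicInterval
  split_ifs
  · exact ⟨le_rfl, by gcongr; linarith⟩
  · exact ⟨le_rfl, by rw [div_le_one (by positivity)]; linarith⟩

lemma exists_dyadicIndex_eq_and_succ_ne (j : ℕ) (t : ℝ) :
    ∃ u ∈ Set.Icc (0 : ℝ) 1,
      dyadicIndex j u = dyadicIndex j t ∧ dyadicIndex (j + 1) u ≠ dyadicIndex (j + 1) t := by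
  set a := dyadicIndex (j + 1) t
  have ha1 : 1 ≤ a := one_le_dyadicIndex _ _
  have ha2 : a ≤ 2 ^ (j + 1) := dyadicIndex_le _ _
  obtain ⟨b, hb1, hb2, hab, hne⟩ :
      ∃ b, 1 ≤ b ∧ b ≤ 2 ^ (j + 1) ∧ (b + 1) / 2 = (a + 1) / 2 ∧ b ≠ a := by
    rw [pow_succ] at *
    rcases Nat.even_or_odd' a with ⟨c, hc | hc⟩
    · exact ⟨a - 1, by omega, by omega, by omega, by omega⟩
    · exact ⟨a + 1, by omega, by omega, by omega, by omega⟩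
  obtain ⟨u, hu, rfl⟩ := exists_dyadicIndex_eq hb1 hb2
  exact ⟨u, hu, by rw [dyadicIndex_eq_half, hab, dyadicIndex_eq_half j t], hne⟩

variable {d : ℕ}

lemma mem_unitSquare_iff {p : Pair d} :
    p ∈ unitSquare d ↔
      (∀ i, p.1 i ∈ Set.Icc (0 : ℝ) 1) ∧ ∀ i, p.2 i ∈ Set.Icc (0 : ℝ) 1 := by
  simp only [unitSquare, unitCube, Set.mem_prod, Set.mem_Icc, Pi.le_def, Pi.zero_apply,
    Pi.one_apply, forall_and]

/-- The label of the dyadic cube of level `j` that contains `p`. -/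
def dyadicCode (j : ℕ) (p : Pair d) : Fin d ⊕ Fin d → ℕ :=
  Sum.elim (fun i => dyadicIndex j (p.1 i)) (fun i => dyadicIndex j (p.2 i))

lemma dyadicCode_eq_iff {j : ℕ} {p : Pair d} {l : Fin d ⊕ Fin d → ℕ} :
    dyadicCode j p = l ↔ (∀ i, dyadicIndex j (p.1 i) = l (Sum.inl i)) ∧
      ∀ i, dyadicIndex j (p.2 i) = l (Sum.inr i) := by
  rw [funext_iff, Sum.forall]; rfl

/-- The dyadic cube of level `j` that contains `p`. -/
def dyadicCell (j : ℕ) (p : Pair d) : Set (Pair d) :=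
  {q | q ∈ unitSquare d ∧ dyadicCode j q = dyadicCode j p}

lemma dyadicCube_eq {j : ℕ} {l : Fin d ⊕ Fin d → ℕ} (hl : ∀ i, l i ∈ Finset.Icc 1 (2 ^ j)) :
    dyadicCube j l = {q : Pair d | q ∈ unitSquare d ∧ dyadicCode j q = l} := by
  ext q
  simp only [Finset.mem_Icc] at hl
  simp only [dyadicCube, Set.mem_ofPred_eq, mem_unitSquare_iff, dyadicCode_eq_iff,
    fun i => mem_dyadicInterval_iff (t := q.1 i) (hl (Sum.inl i)).1 (hl (Sum.inl i)).2,
    fun i => mem_dyadicInterval_iff (t := q.2 i) (hl (Sum.inr i)).1 (hl (Sum.inr i)).2,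
    forall_and]
  tauto

lemma dyadicCode_mem (j : ℕ) (p : Pair d) (i : Fin d ⊕ Fin d) :
    dyadicCode j p i ∈ Finset.Icc 1 (2 ^ j) := by
  rw [Finset.mem_Icc]
  cases i <;> exact ⟨one_le_dyadicIndex _ _, dyadicIndex_le _ _⟩

lemma exists_dyadicCode_eq {j : ℕ} {l : Fin d ⊕ Fin d → ℕ}
    (hl : ∀ i, l i ∈ Finset.Icc 1 (2 ^ j)) : ∃ p ∈ unitSquare d, dyadicCode j p = l := by
  simp only [Finset.mem_Icc] at hl
  choose t ht hti using fun i => exists_dyadicIndex_eq (hl i).1 (hl i).2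
  refine ⟨(fun i => t (Sum.inl i), fun i => t (Sum.inr i)), ?_, ?_⟩
  · rw [mem_unitSquare_iff]; exact ⟨fun i => ht _, fun i => ht _⟩
  · rw [dyadicCode_eq_iff]; exact ⟨fun i => hti _, fun i => hti _⟩

lemma mem_dyadicCubes_iff {j : ℕ} {K : Set (Pair d)} :
    K ∈ dyadicCubes d j ↔ ∃ p ∈ unitSquare d, K = dyadicCell j p := by
  simp only [dyadicCubes, Finset.mem_image, Fintype.mem_piFinset]
  constructor
  · rintro ⟨l, hl, rfl⟩
    obtain ⟨p, hp, rfl⟩ := exists_dyadicCode_eq hl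
    exact ⟨p, hp, dyadicCube_eq hl⟩
  · rintro ⟨p, -, rfl⟩
    exact ⟨dyadicCode j p, dyadicCode_mem j p, dyadicCube_eq (dyadicCode_mem j p)⟩

lemma mem_dyadicCell_self {j : ℕ} {p : Pair d} (hp : p ∈ unitSquare d) : p ∈ dyadicCell j p :=
  ⟨hp, rfl⟩

lemma dyadicCell_mem_dyadicCubes {j : ℕ} {p : Pair d} (hp : p ∈ unitSquare d) :
    dyadicCell j p ∈ dyadicCubes d j := mem_dyadicCubes_iff.mpr ⟨p, hp, rfl⟩

lemma eq_dyadicCell {j : ℕ} {K : Set (Pair d)} (hK : K ∈ dyadicCubes d j) {p : Pair d}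
    (hp : p ∈ K) : K = dyadicCell j p := by
  obtain ⟨q, -, rfl⟩ := mem_dyadicCubes_iff.mp hK
  ext r
  simp only [dyadicCell, Set.mem_ofPred_eq, hp.2]

lemma subset_unitSquare_of_mem_dyadicCubes {j : ℕ} {K : Set (Pair d)} (hK : K ∈ dyadicCubes d j) :
    K ⊆ unitSquare d := by
  obtain ⟨q, -, rfl⟩ := mem_dyadicCubes_iff.mp hK
  exact fun p hp => hp.1

lemma nonempty_of_mem_dyadicCubes {j : ℕ} {K : Set (Pair d)} (hK : K ∈ dyadicCubes d j) :
    K.Nonempty := by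
  obtain ⟨q, hq, rfl⟩ := mem_dyadicCubes_iff.mp hK
  exact ⟨q, mem_dyadicCell_self hq⟩

lemma dyadicCell_subset {i j : ℕ} (hij : i ≤ j) (p : Pair d) :
    dyadicCell j p ⊆ dyadicCell i p := by
  rintro q ⟨hq, h⟩
  refine ⟨hq, ?_⟩
  rw [dyadicCode_eq_iff] at h ⊢
  exact ⟨fun k => dyadicIndex_eq_of_le hij (h.1 k), fun k => dyadicIndex_eq_of_le hij (h.2 k)⟩

lemma subset_or_subset_of_mem_dyadicCubes {i j : ℕ} {K K' : Set (Pair d)}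
    (hK : K ∈ dyadicCubes d i) (hK' : K' ∈ dyadicCubes d j) (h : (K ∩ K').Nonempty) :
    K ⊆ K' ∨ K' ⊆ K := by
  obtain ⟨p, hp, hp'⟩ := h
  rw [eq_dyadicCell hK hp, eq_dyadicCell hK' hp']
  exact (le_total j i).imp (dyadicCell_subset · p) (dyadicCell_subset · p)

lemma zero_mem_unitSquare : (0 : Pair d) ∈ unitSquare d := by
  rw [mem_unitSquare_iff]; simp

lemma unitSquare_mem_dyadicCubes : unitSquare d ∈ dyadicCubes d 0 := by
  refine mem_dyadicCubes_iff.mpr ⟨0, zero_mem_unitSquare, ?_⟩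
  ext q
  simp only [dyadicCell, Set.mem_ofPred_eq, iff_self_and]
  intro _
  rw [dyadicCode_eq_iff]
  simp [dyadicCode, dyadicIndex]

lemma exists_mem_dyadicCell_notMem_succ (hd : 0 < d) (j : ℕ) {p : Pair d}
    (hp : p ∈ unitSquare d) : ∃ q ∈ dyadicCell j p, q ∉ dyadicCell (j + 1) p := by
  classical
  let i₀ : Fin d := ⟨0, hd⟩
  obtain ⟨u, hu, heq, hne⟩ := exists_dyadicIndex_eq_and_succ_ne j (p.1 i₀)
  refine ⟨(Function.update p.1 i₀ u, p.2), ⟨?_, ?_⟩, fun h => hne ?_⟩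
  · rw [mem_unitSquare_iff] at hp ⊢
    refine ⟨fun i => ?_, hp.2⟩
    rcases eq_or_ne i i₀ with rfl | hi
    · simpa using hu
    · simpa [hi] using hp.1 i
  · rw [dyadicCode_eq_iff]
    refine ⟨fun i => ?_, fun _ => rfl⟩
    rcases eq_or_ne i i₀ with rfl | hi
    · simpa [dyadicCode] using heq
    · simp [hi, dyadicCode]
  · simpa [dyadicCode] using (dyadicCode_eq_iff.mp h.2).1 i₀

lemma measurableSet_unitCube : MeasurableSet (unitCube d) := measurableSet_Icc

lemma measurableSet_unitSquare : MeasurableSet (unitSquare d) :=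
  measurableSet_unitCube.prod measurableSet_unitCube

lemma measurableSet_dyadicInterval (j l : ℕ) : MeasurableSet (dyadicInterval j l) := by
  unfold dyadicInterval
  split_ifs
  · exact measurableSet_Ico
  · exact measurableSet_Icc

lemma exists_eq_prod_of_mem_dyadicCubes {j : ℕ} {K : Set (Pair d)} (hK : K ∈ dyadicCubes d j) :
    ∃ K₁ K₂ : Set (Fin d → ℝ), MeasurableSet K₁ ∧ MeasurableSet K₂ ∧ K = K₁ ×ˢ K₂ := by
  simp only [dyadicCubes, Finset.mem_image] at hK
  obtain ⟨l, -, rfl⟩ := hK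
  refine ⟨Set.univ.pi fun i => dyadicInterval j (l (Sum.inl i)),
    Set.univ.pi fun i => dyadicInterval j (l (Sum.inr i)),
    MeasurableSet.univ_pi fun i => measurableSet_dyadicInterval _ _,
    MeasurableSet.univ_pi fun i => measurableSet_dyadicInterval _ _, ?_⟩
  ext p
  simp [dyadicCube]

lemma measurableSet_of_mem_dyadicCubes {j : ℕ} {K : Set (Pair d)} (hK : K ∈ dyadicCubes d j) :
    MeasurableSet K := by
  obtain ⟨K₁, K₂, h₁, h₂, rfl⟩ := exists_eq_prod_of_mem_dyadicCubes hK
  exact h₁.prod h₂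

end Dyadic

/-! ### Dyadic partitions -/

/-- A finite partition of `[0,1]^{2d}` into dyadic cubes of arbitrary levels. The elements of
`partitions d ℓ` are of this form, and the selection procedure is analysed through this property
alone. -/
structure IsDyadicPartition {d : ℕ} (m : Finset (Set (Pair d))) : Prop where
  exists_level : ∀ K ∈ m, ∃ j, K ∈ dyadicCubes d j
  existsUnique_mem : ∀ p ∈ unitSquare d, ∃! K, K ∈ m ∧ p ∈ K

namespace IsDyadicPartition

variable {d : ℕ} {m m' : Finset (Set (Pair d))}

lemma eq_of_mem (hm : IsDyadicPartition m) {K K' : Set (Pair d)} (hK : K ∈ m) (hK' : K' ∈ m)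
    {p : Pair d} (hp : p ∈ K) (hp' : p ∈ K') : K = K' := by
  obtain ⟨j, hj⟩ := hm.exists_level K hK
  exact (hm.existsUnique_mem p (subset_unitSquare_of_mem_dyadicCubes hj hp)).unique
    ⟨hK, hp⟩ ⟨hK', hp'⟩

lemma subset (hm : IsDyadicPartition m) {K : Set (Pair d)} (hK : K ∈ m) : K ⊆ unitSquare d :=
  let ⟨_, hj⟩ := hm.exists_level K hK
  subset_unitSquare_of_mem_dyadicCubes hj

lemma nonempty (hm : IsDyadicPartition m) {K : Set (Pair d)} (hK : K ∈ m) : K.Nonempty :=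
  let ⟨_, hj⟩ := hm.exists_level K hK
  nonempty_of_mem_dyadicCubes hj

lemma measurableSet (hm : IsDyadicPartition m) {K : Set (Pair d)} (hK : K ∈ m) :
    MeasurableSet K :=
  let ⟨_, hj⟩ := hm.exists_level K hK
  measurableSet_of_mem_dyadicCubes hj

lemma pairwiseDisjoint (hm : IsDyadicPartition m) :
    (m : Set (Set (Pair d))).PairwiseDisjoint id := by
  intro K hK K' hK' hne
  exact Set.disjoint_left.mpr fun p hp hp' => hne (hm.eq_of_mem hK hK' hp hp')

lemma biUnion_eq (hm : IsDyadicPartition m) : ⋃ K ∈ m, K = unitSquare d := by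
  refine Set.Subset.antisymm (Set.iUnion₂_subset fun K hK => hm.subset hK) fun p hp => ?_
  obtain ⟨K, ⟨hK, hpK⟩, -⟩ := hm.existsUnique_mem p hp
  exact Set.mem_biUnion hK hpK

lemma sum_mul_indicator (hm : IsDyadicPartition m) (a : Set (Pair d) → ℝ)
    {K : Set (Pair d)} (hK : K ∈ m) {p : Pair d} (hp : p ∈ K) :
    ∑ K' ∈ m, a K' * K'.indicator (fun _ => (1 : ℝ)) p = a K := by
  rw [Finset.sum_eq_single_of_mem K hK fun K' hK' hne => ?_]
  · simp [hp]
  · rw [Set.indicator_of_notMem (fun hp' => hne (hm.eq_of_mem hK' hK hp' hp)), mul_zero]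

lemma singleton : IsDyadicPartition ({unitSquare d} : Finset (Set (Pair d))) where
  exists_level K hK := ⟨0, Finset.mem_singleton.mp hK ▸ unitSquare_mem_dyadicCubes⟩
  existsUnique_mem p hp := ⟨unitSquare d, by simpa using hp, fun K hK => by simpa using hK.1⟩

lemma of_isStep (hm : IsDyadicPartition m) (h : IsStep m m') : IsDyadicPartition m' := by
  classical
  obtain ⟨D, hD, j, hj, hm'⟩ := h
  have mem_iff : ∀ K', K' ∈ m' ↔
      (K' ∈ m ∧ K' ∉ D) ∨ ∃ K ∈ D, K' ∈ dyadicCubes d (j K + 1) ∧ K' ⊆ K := by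
    simp [hm']
  constructor
  · intro K' hK'
    rcases (mem_iff K').mp hK' with hK' | ⟨_, -, hK', -⟩
    · exact hm.exists_level K' hK'.1
    · exact ⟨_, hK'⟩
  intro p hp
  obtain ⟨K, ⟨hKm, hpK⟩, huniq⟩ := hm.existsUnique_mem p hp
  by_cases hKD : K ∈ D
  · have hcell : dyadicCell (j K + 1) p ⊆ K :=
      (dyadicCell_subset (Nat.le_succ _) p).trans (eq_dyadicCell (hj K hKD) hpK).ge
    refine ⟨dyadicCell (j K + 1) p, ⟨(mem_iff _).mpr (Or.inr ⟨K, hKD,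
      dyadicCell_mem_dyadicCubes hp, hcell⟩), mem_dyadicCell_self hp⟩, ?_⟩
    rintro K' ⟨hK', hpK'⟩
    rcases (mem_iff K').mp hK' with ⟨hK'm, hK'D⟩ | ⟨K'', hK''D, hK', hsub⟩
    · exact absurd (huniq K' ⟨hK'm, hpK'⟩ ▸ hKD) hK'D
    · obtain rfl := huniq K'' ⟨hD hK''D, hsub hpK'⟩
      exact eq_dyadicCell hK' hpK'
  · refine ⟨K, ⟨(mem_iff K).mpr (Or.inl ⟨hKm, hKD⟩), hpK⟩, ?_⟩
    rintro K' ⟨hK', hpK'⟩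
    rcases (mem_iff K').mp hK' with ⟨hK'm, -⟩ | ⟨K'', hK''D, -, hsub⟩
    · exact huniq K' ⟨hK'm, hpK'⟩
    · exact absurd (huniq K'' ⟨hD hK''D, hsub hpK'⟩ ▸ hK''D) hKD

lemma of_mem_partitionsAfter {k : ℕ} (h : m ∈ partitionsAfter d k) : IsDyadicPartition m := by
  induction k generalizing m with
  | zero => exact (Set.mem_singleton_iff.mp h) ▸ singleton
  | succ k ih =>
    obtain ⟨m₀, hm₀, hstep⟩ := h
    exact (ih hm₀).of_isStep hstep

lemma of_mem_partitions {ℓ : ℕ∞} (h : m ∈ partitions d ℓ) : IsDyadicPartition m :=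
  let ⟨_, _, hk⟩ := h
  of_mem_partitionsAfter hk

lemma inter_eq_left_or_right (hm : IsDyadicPartition m) (hm' : IsDyadicPartition m')
    {K K' : Set (Pair d)} (hK : K ∈ m) (hK' : K' ∈ m') (h : (K ∩ K').Nonempty) :
    K ∩ K' = K ∨ K ∩ K' = K' := by
  obtain ⟨i, hi⟩ := hm.exists_level K hK
  obtain ⟨j, hj⟩ := hm'.exists_level K' hK'
  exact (subset_or_subset_of_mem_dyadicCubes hi hj h).imp
    Set.inter_eq_left.mpr Set.inter_eq_right.mpr

open Classical in
lemma card_join (hm : IsDyadicPartition m) (K : Set (Pair d)) :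
    (join m K).card = (m.filter fun K' => (K ∩ K').Nonempty).card := by
  unfold join
  simp only [Set.inter_comm _ K]
  refine Finset.card_image_of_injOn fun K₁ h₁ K₂ h₂ (h : K ∩ K₁ = K ∩ K₂) => ?_
  simp only [Finset.coe_filter, Set.mem_ofPred_eq] at h₁ h₂
  obtain ⟨p, hp⟩ := h₁.2
  exact hm.eq_of_mem h₁.1 h₂.1 hp.2 (h ▸ hp).2

/-- The nonempty intersections `K ∩ K'` are distinct elements of `m ∪ m'`. -/
lemma sum_card_join_le [DecidableEq (Set (Pair d))] (hm : IsDyadicPartition m)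
    (hm' : IsDyadicPartition m') : ∑ K ∈ m, (join m' K).card ≤ (m ∪ m').card := by
  classical
  simp only [hm'.card_join]
  rw [← Finset.card_sigma]
  refine Finset.card_le_card_of_injOn (fun q => q.1 ∩ q.2) ?_ ?_
  · rintro ⟨K, K'⟩ h
    simp only [Finset.coe_sigma, Finset.coe_filter, Set.mem_sigma_iff, Finset.mem_coe,
      Set.mem_ofPred_eq] at h
    simp only [Finset.coe_union, Set.mem_union, Finset.mem_coe]
    rcases hm.inter_eq_left_or_right hm' h.1 h.2.1 h.2.2 with h' | h' <;> rw [h']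
    · exact Or.inl h.1
    · exact Or.inr h.2.1
  · rintro ⟨K₁, K₁'⟩ h₁ ⟨K₂, K₂'⟩ h₂ h
    simp only [Finset.coe_sigma, Finset.coe_filter, Set.mem_sigma_iff, Finset.mem_coe,
      Set.mem_ofPred_eq] at h₁ h₂ h
    obtain ⟨p, hp⟩ := h₁.2.2
    have hp' : p ∈ K₂ ∩ K₂' := h ▸ hp
    obtain rfl := hm.eq_of_mem h₁.1 h₂.1 hp.1 hp'.1
    obtain rfl := hm'.eq_of_mem h₁.2.1 h₂.2.1 hp.2 hp'.2
    rfl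

lemma exists_mem_subset_dyadicCell_disjoint_succ (hm : IsDyadicPartition m) (hd : 0 < d)
    {b i : ℕ} (hi : i < b) {K : Set (Pair d)} (hKm : K ∈ m) (hK : K ∈ dyadicCubes d b)
    {p : Pair d} (hp : p ∈ K) :
    ∃ E ∈ m, E ⊆ dyadicCell i p ∧ Disjoint E (dyadicCell (i + 1) p) := by
  have hpA := hm.subset hKm hp
  have mem_cubes (k : ℕ) : dyadicCell k p ∈ dyadicCubes d k := dyadicCell_mem_dyadicCubes hpA
  obtain ⟨q, hq, hq'⟩ := exists_mem_dyadicCell_notMem_succ hd i hpA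
  obtain ⟨E, ⟨hE, hqE⟩, -⟩ := hm.existsUnique_mem q hq.1
  obtain ⟨e, he⟩ := hm.exists_level E hE
  have hpE : p ∉ E := by
    intro hpE
    obtain rfl := hm.eq_of_mem hE hKm hpE hp
    exact hq' (dyadicCell_subset hi p (eq_dyadicCell hK hp ▸ hqE))
  refine ⟨E, hE, ?_, ?_⟩
  · exact (subset_or_subset_of_mem_dyadicCubes he (mem_cubes i) ⟨q, hqE, hq⟩).resolve_right
      fun h => hpE (h (mem_dyadicCell_self hpA))
  · rw [Set.disjoint_iff_inter_eq_empty, ← Set.not_nonempty_iff_eq_empty]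
    intro h
    rcases subset_or_subset_of_mem_dyadicCubes he (mem_cubes (i + 1)) h with h | h
    · exact hq' (h hqE)
    · exact hpE (h (mem_dyadicCell_self hpA))

/-- Deep cubes are expensive: a partition that contains a cube of level `b` inside a cube `K` of
level `a` also contains a piece of `K` between any two intermediate levels. -/
lemma le_add_card_join (hd : 0 < d) (hm : IsDyadicPartition m) {a b : ℕ} {K K' : Set (Pair d)}
    (hK : K ∈ dyadicCubes d a) (hK'm : K' ∈ m) (hK' : K' ∈ dyadicCubes d b)
    (h : (K ∩ K').Nonempty) : b ≤ a + (join m K).card := by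
  classical
  obtain ⟨p, hp, hp'⟩ := h
  have hE (i : ℕ) (hi : i < b) :=
    hm.exists_mem_subset_dyadicCell_disjoint_succ hd hi hK'm hK' hp'
  choose! E hEm hEsub hEdisj using hE
  have hne : ∀ i j, i < j → j < b → E i ≠ E j := by
    intro i j hij hjb heq
    obtain ⟨r, hr⟩ := hm.nonempty (hEm j hjb)
    exact Set.disjoint_left.mp (hEdisj i (hij.trans hjb)) (heq ▸ hr)
      (dyadicCell_subset hij p (hEsub j hjb hr))
  rw [hm.card_join]
  suffices hcard : (Finset.Ico a b).card ≤ (m.filter fun K' => (K ∩ K').Nonempty).card by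
    rw [Nat.card_Ico] at hcard
    omega
  refine Finset.card_le_card_of_injOn E (fun i hi => ?_) fun i hi j hj hij => ?_
  · rw [Finset.coe_Ico, Set.mem_Ico] at hi
    obtain ⟨r, hr⟩ := hm.nonempty (hEm i hi.2)
    rw [Finset.coe_filter]
    refine ⟨hEm i hi.2, r, ?_, hr⟩
    rw [eq_dyadicCell hK hp]
    exact dyadicCell_subset hi.1 p (hEsub i hi.2 hr)
  · rw [Finset.coe_Ico, Set.mem_Ico] at hi hj
    rcases lt_trichotomy i j with h | h | h
    · exact absurd hij (hne i j h hj.2)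
    · exact h
    · exact absurd hij.symm (hne j i h hi.2)

lemma level_le_card (hd : 0 < d) (hm : IsDyadicPartition m) {b : ℕ} {K : Set (Pair d)}
    (hKm : K ∈ m) (hK : K ∈ dyadicCubes d b) : b ≤ m.card := by
  classical
  have h := hm.le_add_card_join hd unitSquare_mem_dyadicCubes hKm hK
    ((hm.nonempty hKm).mono (Set.subset_inter (hm.subset hKm) subset_rfl))
  rw [zero_add, hm.card_join] at h
  exact h.trans (Finset.card_filter_le _ _)

lemma card_pos (hm : IsDyadicPartition m) : 0 < m.card := by
  obtain ⟨K, ⟨hK, -⟩, -⟩ := hm.existsUnique_mem 0 zero_mem_unitSquare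
  exact Finset.card_pos.mpr ⟨K, hK⟩

end IsDyadicPartition

lemma singleton_mem_partitions (d : ℕ) (ℓ : ℕ∞) :
    ({unitSquare d} : Finset (Set (Pair d))) ∈ partitions d ℓ :=
  ⟨0, by simp, by simp [partitionsAfter]⟩

lemma countable_partitions (d : ℕ) (ℓ : ℕ∞) : (partitions d ℓ).Countable := by
  have hcubes : (⋃ j, (dyadicCubes d j : Set (Set (Pair d)))).Countable :=
    Set.countable_iUnion fun j => (dyadicCubes d j).countable_toSet
  refine ((Set.countable_ofPred_finite_subset hcubes).preimage_of_injOn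
    (f := fun m : Finset (Set (Pair d)) => (m : Set (Set (Pair d))))
    Finset.coe_injective.injOn).mono ?_
  refine fun m hm => ⟨m.finite_toSet, fun K hK => ?_⟩
  obtain ⟨j, hj⟩ := (IsDyadicPartition.of_mem_partitions hm).exists_level K hK
  exact Set.mem_iUnion.mpr ⟨j, hj⟩

lemma isDyadicPartition_dyadicCubes (d j : ℕ) : IsDyadicPartition (dyadicCubes d j) where
  exists_level _ hK := ⟨j, hK⟩
  existsUnique_mem p hp := ⟨dyadicCell j p,
    ⟨dyadicCell_mem_dyadicCubes hp, mem_dyadicCell_self hp⟩, fun _ hK => eq_dyadicCell hK.1 hK.2⟩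

/-! ### The test between two constants -/

section TestFunction

/-- The weight that the test between the constants `a` and `b` gives to an observed transition
(`0` at `a = b = 0`). -/
def testWeight (a b : ℝ) : ℝ := (√b - √a) / (√2 * √(a + b))

/-- The deterministic part of the test between the constants `a` and `b`: the contribution of a
unit of occupation time to `n (α H² + T)`. -/
def testDrift (a b : ℝ) : ℝ :=
  alpha / 2 * (√b - √a) ^ 2 + √(a + b) * (√b - √a) / (2 * √2) + (a - b) / 2

/-- The contribution to `n (α H² + T)` of a cell with occupation time `D` and `N` observed
transitions, for functions equal to `a` and `b` on that cell. -/
def cellScore (D N a b : ℝ) : ℝ := testDrift a b * D + testWeight a b * N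

lemma inv_sqrt_two_eq : 1 / √2 = 1 - 2 * alpha := by
  unfold alpha
  ring

lemma alpha_gt : 0.146 < alpha := by
  have : 1 / √2 < 0.708 := by
    rw [div_lt_iff₀ (by positivity), ← div_lt_iff₀' (by norm_num), Real.lt_sqrt (by norm_num)]
    norm_num
  linarith [inv_sqrt_two_eq]

lemma alpha_lt : alpha < 0.147 := by
  have : 0.707 < 1 / √2 := by
    rw [lt_div_iff₀ (by positivity), ← lt_div_iff₀' (by norm_num),
      Real.sqrt_lt' (by norm_num)]
    norm_num
  linarith [inv_sqrt_two_eq]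

lemma testWeight_swap (a b : ℝ) : testWeight b a = -testWeight a b := by
  unfold testWeight
  rw [add_comm b a]
  ring

lemma testDrift_add_swap (a b : ℝ) :
    testDrift a b + testDrift b a = alpha * (√b - √a) ^ 2 := by
  unfold testDrift
  rw [add_comm b a]
  ring

lemma cellScore_add_swap_nonneg {D : ℝ} (hD : 0 ≤ D) (N a b : ℝ) :
    0 ≤ cellScore D N a b + cellScore D N b a := by
  have hα : 0 ≤ alpha := by linarith [alpha_gt]
  have : cellScore D N a b + cellScore D N b a = alpha * (√b - √a) ^ 2 * D := by
    rw [← testDrift_add_swap]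
    unfold cellScore
    rw [testWeight_swap a b]
    ring
  rw [this]
  positivity

variable {a b : ℝ}

lemma abs_testWeight_le (ha : 0 ≤ a) (hb : 0 ≤ b) : |testWeight a b| ≤ 1 / √2 := by
  have hdiff : |√b - √a| ≤ √(a + b) := by
    apply Real.abs_le_sqrt
    nlinarith [Real.sq_sqrt ha, Real.sq_sqrt hb, Real.sqrt_nonneg a, Real.sqrt_nonneg b]
  unfold testWeight
  rw [abs_div, abs_of_nonneg (by positivity : 0 ≤ √2 * √(a + b)), mul_comm, ← div_div]
  gcongr
  exact div_le_one_of_le₀ hdiff (Real.sqrt_nonneg _)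

lemma abs_testWeight_le_one (ha : 0 ≤ a) (hb : 0 ≤ b) : |testWeight a b| ≤ 1 := by
  linarith [abs_testWeight_le ha hb, inv_sqrt_two_eq, alpha_gt]

lemma testDrift_le (ha : 0 ≤ a) (hb : 0 ≤ b) : testDrift a b ≤ 2 * (a + b) := by
  have hroots : (√b - √a) ^ 2 ≤ a + b := by
    nlinarith [Real.sq_sqrt ha, Real.sq_sqrt hb, Real.sqrt_nonneg a, Real.sqrt_nonneg b]
  have hproduct : √(a + b) * (√b - √a) / (2 * √2) ≤ (a + b) / 2 := by
    have h2 : (1 : ℝ) ≤ √2 := Real.one_le_sqrt.mpr one_le_two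
    rw [div_le_div_iff₀ (by positivity) two_pos]
    nlinarith [Real.sq_sqrt (add_nonneg ha hb), sq_nonneg (√(a + b) - (√b - √a)),
      mul_nonneg (add_nonneg ha hb) (sub_nonneg.mpr h2)]
  unfold testDrift
  nlinarith [alpha_gt, alpha_lt, sq_nonneg (√b - √a)]

lemma cellScore_le (ha : 0 ≤ a) (hb : 0 ≤ b) {D N : ℝ} (hD : 0 ≤ D) (hN : 0 ≤ N) :
    cellScore D N a b ≤ N + 2 * (a * D + b * D) := by
  have hdrift := mul_le_mul_of_nonneg_right (testDrift_le ha hb) hD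
  have hweight := mul_le_mul_of_nonneg_right
    ((le_abs_self _).trans (abs_testWeight_le_one ha hb)) hN
  unfold cellScore
  linarith

lemma exists_quadratic_mean (ha : 0 ≤ a) (hb : 0 ≤ b) :
    ∃ r : ℝ, 0 ≤ r ∧ r ^ 2 = (a + b) / 2 ∧ 2 * r * testWeight a b = √b - √a ∧
      testDrift a b = alpha / 2 * (√b - √a) ^ 2 + r * (√b - √a) / 2 + (a - b) / 2 := by
  have h2 : √2 * √2 = 2 := Real.mul_self_sqrt zero_le_two
  refine ⟨√(a + b) / √2, by positivity, ?_, ?_, ?_⟩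
  · rw [div_pow, Real.sq_sqrt (by positivity), Real.sq_sqrt zero_le_two]
  · rcases (add_nonneg ha hb).eq_or_lt with h0 | hpos
    · obtain rfl : a = 0 := by linarith
      obtain rfl : b = 0 := by linarith
      simp
    · have : √(a + b) ≠ 0 := (Real.sqrt_pos.mpr hpos).ne'
      unfold testWeight
      field_simp
      linear_combination (√a - √b) * h2
  · unfold testDrift
    ring

/-- With `p = √a`, `q = √b`, `σ = √s`, `w` the test weight and `r` the quadratic mean of `p` and
`q`, one has `w r² = r (q - p) / 2`, hence the mean part of the score is
`α (q - p)² / 2 + w (r - σ)² + (σ - p)² / 2 - (σ - q)² / 2`; and `(r - σ)²` is at most the average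
of `(σ - p)²` and `(σ - q)²` because `r ≥ (p + q) / 2`. -/
lemma testDrift_add_testWeight_mul_le (ha : 0 ≤ a) (hb : 0 ≤ b) {s : ℝ} (hs : 0 ≤ s) :
    testDrift a b + testWeight a b * s + testWeight a b ^ 2 * s / 150 ≤
      2 * (√s - √a) ^ 2 - (√s - √b) ^ 2 / 60 := by
  obtain ⟨r, hr, hr2, hw, hdrift⟩ := exists_quadratic_mean ha hb
  have hw_le := abs_testWeight_le ha hb
  rw [inv_sqrt_two_eq, abs_le] at hw_le
  rw [hdrift]
  generalize testWeight a b = w at hw hw_le ⊢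
  obtain ⟨p, hp, rfl⟩ : ∃ p, 0 ≤ p ∧ p ^ 2 = a := ⟨√a, Real.sqrt_nonneg a, Real.sq_sqrt ha⟩
  obtain ⟨q, hq, rfl⟩ : ∃ q, 0 ≤ q ∧ q ^ 2 = b := ⟨√b, Real.sqrt_nonneg b, Real.sq_sqrt hb⟩
  obtain ⟨σ, hσ, rfl⟩ : ∃ σ, 0 ≤ σ ∧ σ ^ 2 = s := ⟨√s, Real.sqrt_nonneg s, Real.sq_sqrt hs⟩
  rw [Real.sqrt_sq hp, Real.sqrt_sq hq] at hw ⊢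
  rw [Real.sqrt_sq hσ]
  have hα := alpha_gt
  have hα' := alpha_lt
  have hr_ge : (p + q) / 2 ≤ r := by nlinarith [sq_nonneg (p - q)]
  have hrσ : (r - σ) ^ 2 ≤ ((σ - p) ^ 2 + (σ - q) ^ 2) / 2 := by nlinarith
  have hpq : (q - p) ^ 2 ≤ 3 * (σ - p) ^ 2 + 3 / 2 * (σ - q) ^ 2 := by
    nlinarith [sq_nonneg (2 * (σ - p) - (q - σ))]
  have hmean : r * (q - p) / 2 + (p ^ 2 - q ^ 2) / 2 + w * σ ^ 2 =
      w * (r - σ) ^ 2 + (σ - p) ^ 2 / 2 - (σ - q) ^ 2 / 2 := by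
    linear_combination (σ - r / 2) * hw
  have hmean_le : w * (r - σ) ^ 2 ≤
      (1 - 2 * alpha) * (((σ - p) ^ 2 + (σ - q) ^ 2) / 2) := by
    have := mul_le_mul_of_nonneg_right hw_le.2 (sq_nonneg (r - σ))
    have := mul_le_mul_of_nonneg_left hrσ (by linarith : 0 ≤ 1 - 2 * alpha)
    linarith
  have hnoise : w ^ 2 * σ ^ 2 ≤ (q - p) ^ 2 / 2 + (σ - p) ^ 2 + (σ - q) ^ 2 := by
    have hw2 : w ^ 2 ≤ 1 := by nlinarith
    have : w ^ 2 * σ ^ 2 ≤ 2 * (w ^ 2 * r ^ 2) + 2 * (w ^ 2 * (r - σ) ^ 2) := by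
      nlinarith [mul_nonneg (sq_nonneg w) (sq_nonneg (2 * r - σ))]
    have : w ^ 2 * r ^ 2 = (q - p) ^ 2 / 4 := by rw [← hw]; ring
    have := mul_le_mul hw2 hrσ (sq_nonneg _) zero_le_one
    linarith
  have := mul_le_mul_of_nonneg_left hpq (by linarith : 0 ≤ alpha / 2)
  nlinarith [sq_nonneg (σ - p), sq_nonneg (σ - q)]

lemma mul_sub_le_of_sqrt_sub_sqrt_sq_le {w N S δ : ℝ} (hw : |w| ≤ 1) (hN : 0 ≤ N) (hS : 0 ≤ S)
    (hδ : (√N - √S) ^ 2 ≤ δ) : w * (N - S) ≤ w ^ 2 * S / 150 + 151 * δ := by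
  rw [abs_le] at hw
  rw [← Real.sq_sqrt hN, ← Real.sq_sqrt hS, Real.sqrt_sq (Real.sqrt_nonneg _),
    Real.sqrt_sq (Real.sqrt_nonneg _)] at *
  nlinarith [sq_nonneg (w * √S - 150 * (√N - √S)), sq_nonneg (√N - √S)]

end TestFunction

/-! ### Loss and score on a cell -/

section Cell

variable {α : Type*} [MeasurableSpace α] (ν τ : Measure α) (s : α → ℝ) (K : Set α)

/-- Twice the (unnormalized) squared Hellinger distance on `K` between `s` and the constant `a`. -/
def cellLoss (a : ℝ) : ℝ := ∫ p in K, (√(s p) - √a) ^ 2 ∂ν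

/-- The value on `K` of the histogram built on the occupation measure `ν` and the measure `τ` of
the observed transitions (`0` if `ν K = 0`). -/
def cellRatio : ℝ := τ.real K / ν.real K

variable {ν τ s K}

lemma cellLoss_nonneg (a : ℝ) : 0 ≤ cellLoss ν s K a :=
  integral_nonneg fun _ => sq_nonneg _

lemma cellRatio_nonneg : 0 ≤ cellRatio ν τ K := div_nonneg measureReal_nonneg measureReal_nonneg

lemma cellRatio_mul_le : cellRatio ν τ K * ν.real K ≤ τ.real K := by
  rcases eq_or_ne (ν.real K) 0 with h0 | h0
  · rw [h0, mul_zero]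
    exact measureReal_nonneg
  · exact (div_mul_cancel₀ _ h0).le

variable [IsFiniteMeasure ν]

lemma integrable_sqrt (hint : Integrable s ν) : Integrable (fun p => √(s p)) ν := by
  refine Integrable.mono' ((integrable_const 1).add hint.abs)
    (Real.continuous_sqrt.comp_aestronglyMeasurable hint.aestronglyMeasurable) ?_
  refine ae_of_all _ fun p => ?_
  rw [Real.norm_of_nonneg (Real.sqrt_nonneg _)]
  refine Real.sqrt_le_iff.mpr ⟨?_, ?_⟩ <;> dsimp only [Pi.add_apply]
  · positivity
  · nlinarith [le_abs_self (s p), abs_nonneg (s p)]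

lemma integrable_sqrt_sub_sq (hs : ∀ p, 0 ≤ s p) (hint : Integrable s ν) (c : ℝ) :
    Integrable (fun p => (√(s p) - c) ^ 2) ν := by
  have : (fun p => (√(s p) - c) ^ 2) = fun p => s p - 2 * c * √(s p) + c ^ 2 := by
    ext p
    rw [sub_sq, Real.sq_sqrt (hs p)]
    ring
  rw [this]
  exact (hint.sub ((integrable_sqrt hint).const_mul _)).add (integrable_const _)

variable (hs : ∀ p, 0 ≤ s p) (hint : Integrable s ν)

include hs hint

lemma cellLoss_eq {a : ℝ} (ha : 0 ≤ a) : cellLoss ν s K a =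
    ∫ p in K, s p ∂ν - 2 * √a * ∫ p in K, √(s p) ∂ν + a * ν.real K := by
  have hcross : Integrable (fun p => 2 * √a * √(s p)) (ν.restrict K) :=
    (integrable_sqrt hint).restrict.const_mul _
  have hdiff : Integrable (fun p => s p - 2 * √a * √(s p)) (ν.restrict K) :=
    hint.restrict.sub hcross
  have : ∀ p, (√(s p) - √a) ^ 2 = s p - 2 * √a * √(s p) + a := fun p => by
    rw [sub_sq, Real.sq_sqrt (hs p), Real.sq_sqrt ha]
    ring
  simp only [cellLoss, this]
  rw [integral_add hdiff (integrable_const _), integral_sub hint.restrict hcross,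
    integral_const_mul, setIntegral_const, smul_eq_mul, mul_comm a]

lemma cellLoss_sq_div_le {a : ℝ} (ha : 0 ≤ a) :
    cellLoss ν s K (((∫ p in K, √(s p) ∂ν) / ν.real K) ^ 2) ≤ cellLoss ν s K a := by
  have hR : 0 ≤ (∫ p in K, √(s p) ∂ν) / ν.real K :=
    div_nonneg (integral_nonneg fun _ => Real.sqrt_nonneg _) measureReal_nonneg
  rw [cellLoss_eq hs hint (sq_nonneg _), cellLoss_eq hs hint ha, Real.sqrt_sq hR]
  rcases eq_or_ne (ν.real K) 0 with h0 | h0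
  · rw [h0]
    rw [measureReal_eq_zero_iff] at h0
    simp [Measure.restrict_eq_zero.mpr h0]
  · have : 0 ≤ ν.real K * (√a - (∫ p in K, √(s p) ∂ν) / ν.real K) ^ 2 :=
      mul_nonneg measureReal_nonneg (sq_nonneg _)
    rw [sub_sq, Real.sq_sqrt ha] at this
    field_simp at this ⊢
    linarith

lemma sq_integral_sqrt_le :
    (∫ p in K, √(s p) ∂ν) ^ 2 ≤ (∫ p in K, s p ∂ν) * ν.real K := by
  have hR : 0 ≤ (∫ p in K, √(s p) ∂ν) / ν.real K :=
    div_nonneg (integral_nonneg fun _ => Real.sqrt_nonneg _) measureReal_nonneg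
  rcases measureReal_nonneg.eq_or_lt' (a := ν.real K) with h0 | hpos
  · rw [measureReal_eq_zero_iff] at h0
    simp [Measure.restrict_eq_zero.mpr h0]
  · have := cellLoss_nonneg (ν := ν) (s := s) (K := K) (((∫ p in K, √(s p) ∂ν) / ν.real K) ^ 2)
    rw [cellLoss_eq hs hint (sq_nonneg _), Real.sqrt_sq hR] at this
    field_simp at this
    linarith

lemma sqrt_sub_sqrt_sq_le_cellLoss {a : ℝ} (ha : 0 ≤ a) :
    (√(∫ p in K, s p ∂ν) - √(a * ν.real K)) ^ 2 ≤ cellLoss ν s K a := by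
  have hS : 0 ≤ ∫ p in K, s p ∂ν := integral_nonneg hs
  have hR : ∫ p in K, √(s p) ∂ν ≤ √((∫ p in K, s p ∂ν) * ν.real K) :=
    Real.le_sqrt_of_sq_le (sq_integral_sqrt_le hs hint)
  rw [cellLoss_eq hs hint ha, sub_sq, Real.sq_sqrt hS,
    Real.sq_sqrt (mul_nonneg ha measureReal_nonneg), Real.sqrt_mul ha]
  rw [Real.sqrt_mul hS] at hR
  nlinarith [mul_le_mul_of_nonneg_left hR (Real.sqrt_nonneg a)]

lemma cellLoss_le_two_mul_add {a b : ℝ} :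
    cellLoss ν s K b ≤ 2 * cellLoss ν s K a + 2 * ((√a - √b) ^ 2 * ν.real K) := by
  have hint_sq (c : ℝ) := (integrable_sqrt_sub_sq hs hint c).restrict (s := K)
  calc cellLoss ν s K b
      ≤ ∫ p in K, (2 * (√(s p) - √a) ^ 2 + 2 * (√a - √b) ^ 2) ∂ν := by
        refine integral_mono (hint_sq _) (((hint_sq _).const_mul 2).add (integrable_const _))
          fun p => ?_
        dsimp only
        nlinarith [sq_nonneg (√(s p) - √a - (√a - √b))]
    _ = 2 * cellLoss ν s K a + 2 * ((√a - √b) ^ 2 * ν.real K) := by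
        rw [integral_add ((hint_sq _).const_mul 2) (integrable_const _), integral_const_mul,
          setIntegral_const, smul_eq_mul, cellLoss]
        ring

lemma cellLoss_cellRatio_le {a δ : ℝ} (ha : 0 ≤ a)
    (hδ : (√(τ.real K) - √(∫ p in K, s p ∂ν)) ^ 2 ≤ δ) :
    cellLoss ν s K (cellRatio ν τ K) ≤ 6 * cellLoss ν s K a + 4 * δ := by
  rcases eq_or_ne (ν.real K) 0 with h0 | h0
  · have : 0 ≤ δ := (sq_nonneg _).trans hδ
    rw [measureReal_eq_zero_iff] at h0
    simp only [cellLoss, Measure.restrict_eq_zero.mpr h0, integral_zero_measure]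
    linarith
  have hroots : (√a - √(cellRatio ν τ K)) ^ 2 * ν.real K =
      (√(a * ν.real K) - √(τ.real K)) ^ 2 := by
    have hN : τ.real K = cellRatio ν τ K * ν.real K := by rw [cellRatio, div_mul_cancel₀ _ h0]
    rw [hN, Real.sqrt_mul ha, Real.sqrt_mul cellRatio_nonneg, ← sub_mul, mul_pow,
      Real.sq_sqrt measureReal_nonneg]
  have hloss := cellLoss_le_two_mul_add hs hint (K := K) (a := a) (b := cellRatio ν τ K)
  have hS := sqrt_sub_sqrt_sq_le_cellLoss hs hint (K := K) ha
  rw [hroots] at hloss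
  nlinarith [sq_nonneg (√(a * ν.real K) + √(τ.real K) - 2 * √(∫ p in K, s p ∂ν))]

lemma testDrift_mul_add_testWeight_mul_integral_le {a b : ℝ} (ha : 0 ≤ a) (hb : 0 ≤ b) :
    testDrift a b * ν.real K + testWeight a b * ∫ p in K, s p ∂ν
        + testWeight a b ^ 2 * (∫ p in K, s p ∂ν) / 150 ≤
      2 * cellLoss ν s K a - cellLoss ν s K b / 60 := by
  have hint_sq (c : ℝ) := (integrable_sqrt_sub_sq hs hint c).restrict (s := K)
  have hlinear : Integrable (fun p => testDrift a b + testWeight a b * s p) (ν.restrict K) :=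
    (integrable_const _).add (hint.restrict.const_mul _)
  have hnoise : Integrable (fun p => testWeight a b ^ 2 * s p / 150) (ν.restrict K) :=
    (hint.restrict.const_mul _).div_const _
  calc testDrift a b * ν.real K + testWeight a b * ∫ p in K, s p ∂ν
        + testWeight a b ^ 2 * (∫ p in K, s p ∂ν) / 150
      = ∫ p in K, (testDrift a b + testWeight a b * s p + testWeight a b ^ 2 * s p / 150) ∂ν := by
        rw [integral_add hlinear hnoise,
          integral_add (integrable_const _) (hint.restrict.const_mul _), setIntegral_const,
          integral_const_mul, integral_div, integral_const_mul, smul_eq_mul, mul_comm (ν.real K)]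
    _ ≤ ∫ p in K, (2 * (√(s p) - √a) ^ 2 - (√(s p) - √b) ^ 2 / 60) ∂ν :=
        integral_mono (hlinear.add hnoise)
          (((hint_sq _).const_mul _).sub ((hint_sq _).div_const _))
          fun p => testDrift_add_testWeight_mul_le ha hb (hs p)
    _ = 2 * cellLoss ν s K a - cellLoss ν s K b / 60 := by
        rw [integral_sub ((hint_sq _).const_mul _) ((hint_sq _).div_const _), integral_const_mul,
          integral_div]
        rfl

lemma cellScore_le_cellLoss {a b δ : ℝ} (ha : 0 ≤ a) (hb : 0 ≤ b)
    (hδ : (√(τ.real K) - √(∫ p in K, s p ∂ν)) ^ 2 ≤ δ) :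
    cellScore (ν.real K) (τ.real K) a b ≤
      2 * cellLoss ν s K a - cellLoss ν s K b / 60 + 151 * δ := by
  have hmean := testDrift_mul_add_testWeight_mul_integral_le hs hint (K := K) ha hb
  have hnoise := mul_sub_le_of_sqrt_sub_sqrt_sq_le (abs_testWeight_le_one ha hb)
    measureReal_nonneg (integral_nonneg hs) hδ
  unfold cellScore
  linarith

end Cell

/-! ### Occupation and transition measures of a path -/

section Path

variable {d : ℕ} (μ : Measure (Fin d → ℝ)) (n : ℕ) (x : ℕ → Fin d → ℝ)

/-- The compensator of `transitions n x`: the measure on `ℝ^{2d}` whose mass on `K ⊆ [0,1]^{2d}` is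
`∑ i < n, ∫ 1_K (x i, y) dμ(y)`. -/
def occupation : Measure (Pair d) :=
  ∑ i ∈ Finset.range n, (μ.restrict (unitCube d)).map (Prod.mk (x i))

/-- The counting measure of the `n` transitions `(x i, x (i + 1))` of the path `x`. -/
def transitions : Measure (Pair d) :=
  ∑ i ∈ Finset.range n, Measure.dirac (x i, x (i + 1))

instance : IsFiniteMeasure (transitions n x) := by
  unfold transitions
  infer_instance

instance [IsFiniteMeasure (μ.restrict (unitCube d))] : IsFiniteMeasure (occupation μ n x) := by
  unfold occupation
  infer_instance

variable {μ n x} {K : Set (Pair d)} {f : Pair d → ℝ}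

lemma transitions_real (hK : MeasurableSet K) : (transitions n x).real K =
    ∑ i ∈ Finset.range n, K.indicator (fun _ => (1 : ℝ)) (x i, x (i + 1)) := by
  unfold transitions
  rw [measureReal_def, Measure.finsetSum_apply, ENNReal.toReal_sum fun i _ => measure_ne_top _ _]
  refine Finset.sum_congr rfl fun i _ => ?_
  rw [Measure.dirac_apply' _ hK]
  by_cases h : (x i, x (i + 1)) ∈ K <;> simp [h]

lemma transitions_real_le (hK : MeasurableSet K) : (transitions n x).real K ≤ n := by
  rw [transitions_real hK]
  calc ∑ i ∈ Finset.range n, K.indicator (fun _ => (1 : ℝ)) (x i, x (i + 1))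
      ≤ ∑ _i ∈ Finset.range n, (1 : ℝ) :=
        Finset.sum_le_sum fun i _ => Set.indicator_le_self' (fun _ _ => zero_le_one) _
    _ = n := by simp

lemma sum_indicator_transition (hK : MeasurableSet K) (c : ℝ) :
    ∑ i ∈ Finset.range n, K.indicator (fun _ => c) (x i, x (i + 1)) =
      c * (transitions n x).real K := by
  rw [transitions_real hK, Finset.mul_sum]
  refine Finset.sum_congr rfl fun i _ => ?_
  rw [← Set.indicator_const_mul, mul_one]

lemma integrable_occupation (hf : Measurable f)
    (h : ∀ i, Integrable (fun y => f (x i, y)) (μ.restrict (unitCube d))) :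
    Integrable f (occupation μ n x) :=
  integrable_finsetSum_measure.mpr fun i _ =>
    (integrable_map_measure hf.aestronglyMeasurable measurable_prodMk_left.aemeasurable).mpr (h i)

lemma integral_occupation (hf : Measurable f) (hint : Integrable f (occupation μ n x)) :
    ∫ p, f p ∂occupation μ n x = ∑ i ∈ Finset.range n, ∫ y in unitCube d, f (x i, y) ∂μ := by
  unfold occupation at hint ⊢
  rw [integral_finsetSum_measure (integrable_finsetSum_measure.mp hint)]
  exact Finset.sum_congr rfl fun i _ =>
    integral_map measurable_prodMk_left.aemeasurable hf.aestronglyMeasurable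

lemma setIntegral_occupation (hK : MeasurableSet K) (hf : Measurable f)
    (hint : IntegrableOn f K (occupation μ n x)) : ∫ p in K, f p ∂occupation μ n x =
      ∑ i ∈ Finset.range n, ∫ y in unitCube d, K.indicator f (x i, y) ∂μ := by
  rw [← integral_indicator hK,
    integral_occupation (hf.indicator hK) ((integrable_indicator_iff hK).mpr hint)]

lemma sum_integral_indicator (hK : MeasurableSet K) (hKA : K ⊆ unitSquare d) (hf : Measurable f)
    (hint : IntegrableOn f K (occupation μ n x)) :
    ∑ i ∈ Finset.range n, ∫ y, K.indicator f (x i, y) ∂μ = ∫ p in K, f p ∂occupation μ n x := by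
  rw [setIntegral_occupation hK hf hint]
  refine Finset.sum_congr rfl fun i _ => ?_
  exact (setIntegral_eq_integral_of_forall_compl_eq_zero fun y hy =>
    Set.indicator_of_notMem (fun h => hy (hKA h).2) _).symm

variable [IsFiniteMeasure (μ.restrict (unitCube d))]

lemma occupation_real (hK : MeasurableSet K) : (occupation μ n x).real K =
    ∑ i ∈ Finset.range n, ∫ y in unitCube d, K.indicator (fun _ => (1 : ℝ)) (x i, y) ∂μ := by
  rw [← setIntegral_occupation hK measurable_const integrableOn_const, setIntegral_const,
    smul_eq_mul, mul_one]

lemma sum_integral_indicator_const (hK : MeasurableSet K) (hKA : K ⊆ unitSquare d) (c : ℝ) :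
    ∑ i ∈ Finset.range n, ∫ y, K.indicator (fun _ => c) (x i, y) ∂μ =
      c * (occupation μ n x).real K := by
  rw [sum_integral_indicator hK hKA measurable_const integrableOn_const, setIntegral_const,
    smul_eq_mul, mul_comm]

lemma hellingerSq_indicator_const (hK : MeasurableSet K) (hKA : K ⊆ unitSquare d) (a b : ℝ) :
    hellingerSq μ n x (K.indicator fun _ => a) (K.indicator fun _ => b) =
      1 / (2 * n) * ((√b - √a) ^ 2 * (occupation μ n x).real K) := by
  have : ∀ p, (√(K.indicator (fun _ => a) p) - √(K.indicator (fun _ => b) p)) ^ 2 =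
      K.indicator (fun _ => (√b - √a) ^ 2) p := fun p => by
    by_cases hp : p ∈ K <;> simp [hp, sub_sq_comm]
  simp only [hellingerSq, this, sum_integral_indicator_const hK hKA]

lemma testT_indicator_const (hK : MeasurableSet K) (hKA : K ⊆ unitSquare d) (a b : ℝ) :
    testT μ n x (K.indicator fun _ => a) (K.indicator fun _ => b) =
      1 / (2 * n * √2) * (√(a + b) * (√b - √a) * (occupation μ n x).real K)
        + 1 / (n * √2) * ((√b - √a) / √(a + b) * (transitions n x).real K)
        + 1 / (2 * n) * ((a - b) * (occupation μ n x).real K) := by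
  have hroot : ∀ p, √(K.indicator (fun _ => a) p + K.indicator (fun _ => b) p) *
      (√(K.indicator (fun _ => b) p) - √(K.indicator (fun _ => a) p)) =
      K.indicator (fun _ => √(a + b) * (√b - √a)) p := fun p => by
    by_cases hp : p ∈ K <;> simp [hp]
  have hweight : ∀ p, (√(K.indicator (fun _ => b) p) - √(K.indicator (fun _ => a) p)) /
      √(K.indicator (fun _ => a) p + K.indicator (fun _ => b) p) =
      K.indicator (fun _ => (√b - √a) / √(a + b)) p := fun p => by
    by_cases hp : p ∈ K <;> simp [hp]
  have hdiff : ∀ p, K.indicator (fun _ => a) p - K.indicator (fun _ => b) p =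
      K.indicator (fun _ => a - b) p := fun p => by
    by_cases hp : p ∈ K <;> simp [hp]
  simp only [testT, hroot, hweight, hdiff, sum_integral_indicator_const hK hKA,
    sum_indicator_transition hK]

lemma alpha_mul_hellingerSq_add_testT (hK : MeasurableSet K) (hKA : K ⊆ unitSquare d) (a b : ℝ) :
    alpha * hellingerSq μ n x (K.indicator fun _ => a) (K.indicator fun _ => b)
        + testT μ n x (K.indicator fun _ => a) (K.indicator fun _ => b) =
      1 / n * cellScore ((occupation μ n x).real K) ((transitions n x).real K) a b := by
  rw [hellingerSq_indicator_const hK hKA, testT_indicator_const hK hKA]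
  unfold cellScore testDrift testWeight
  ring

variable {m m' : Finset (Set (Pair d))}

lemma histogramEstimator_eq (hm : IsDyadicPartition m) (p : Pair d) :
    histogramEstimator μ n x m p = ∑ K ∈ m,
      cellRatio (occupation μ n x) (transitions n x) K * K.indicator (fun _ => (1 : ℝ)) p := by
  refine Finset.sum_congr rfl fun K hK => ?_
  rw [cellRatio, occupation_real (hm.measurableSet hK), transitions_real (hm.measurableSet hK)]

lemma indicator_histogramEstimator (hm : IsDyadicPartition m) (hK : K ∈ m) {J : Set (Pair d)}
    (hJ : J ⊆ K) : J.indicator (histogramEstimator μ n x m) =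
      J.indicator fun _ => cellRatio (occupation μ n x) (transitions n x) K :=
  Set.indicator_congr fun p hp => by
    rw [histogramEstimator_eq hm, hm.sum_mul_indicator _ hK (hJ hp)]

end Path

section Additivity

variable {d : ℕ} {m : Finset (Set (Pair d))} {ν : Measure (Pair d)} {K : Set (Pair d)}
  {f : Pair d → ℝ}

lemma IsDyadicPartition.sum_setIntegral_inter (hm : IsDyadicPartition m) (hK : MeasurableSet K)
    (hKA : K ⊆ unitSquare d) (hf : Integrable f ν) :
    ∑ K' ∈ m, ∫ p in K ∩ K', f p ∂ν = ∫ p in K, f p ∂ν := by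
  rw [← integral_biUnion_finset m (fun K' hK' => hK.inter (hm.measurableSet hK'))
    (fun K₁ h₁ K₂ h₂ hne => ((hm.pairwiseDisjoint h₁ h₂ hne).mono
      Set.inter_subset_right Set.inter_subset_right)) fun _ _ => hf.integrableOn,
    ← Set.inter_iUnion₂, hm.biUnion_eq, Set.inter_eq_left.mpr hKA]

lemma IsDyadicPartition.sum_setIntegral (hm : IsDyadicPartition m) (hf : Integrable f ν) :
    ∑ K ∈ m, ∫ p in K, f p ∂ν = ∫ p in unitSquare d, f p ∂ν := by
  rw [← hm.sum_setIntegral_inter measurableSet_unitSquare subset_rfl hf]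
  exact Finset.sum_congr rfl fun K hK => by rw [Set.inter_eq_right.mpr (hm.subset hK)]

lemma IsDyadicPartition.sum_measureReal_inter [IsFiniteMeasure ν] (hm : IsDyadicPartition m)
    (hK : MeasurableSet K) (hKA : K ⊆ unitSquare d) : ∑ K' ∈ m, ν.real (K ∩ K') = ν.real K := by
  simpa using hm.sum_setIntegral_inter hK hKA (integrable_const (1 : ℝ) (μ := ν))

lemma IsDyadicPartition.sum_measureReal [IsFiniteMeasure ν] (hm : IsDyadicPartition m) :
    ∑ K ∈ m, ν.real K = ν.real (unitSquare d) := by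
  simpa using hm.sum_setIntegral (integrable_const (1 : ℝ) (μ := ν))

end Additivity

/-! ### Deterministic comparison of two histograms -/

section Partition

variable {d : ℕ} (ν τ : Measure (Pair d)) (s : Pair d → ℝ)

/-- The contribution of `K` to the comparison of two histograms by the test: `n` times the sum over
`K' ∈ m'` of `α H² + T` on `K ∩ K'`, for the values attached to `K` and to `K'`. -/
def partitionScore (K : Set (Pair d)) (m' : Finset (Set (Pair d))) : ℝ :=
  ∑ K' ∈ m', cellScore (ν.real (K ∩ K')) (τ.real (K ∩ K')) (cellRatio ν τ K) (cellRatio ν τ K')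

/-- Twice the (unnormalized) squared Hellinger distance between `s` and the histogram with values
`cellRatio ν τ K`, `K ∈ m`. -/
def histogramLoss (m : Finset (Set (Pair d))) : ℝ :=
  ∑ K ∈ m, cellLoss ν s K (cellRatio ν τ K)

/-- The mass given by `τ` to each dyadic cube of level at most `J` is close to the one predicted
by `s`, at the scale of square roots. -/
def IsConcentrated (J : ℕ) (δ : ℝ) : Prop :=
  ∀ j ≤ J, ∀ K ∈ dyadicCubes d j, (√(τ.real K) - √(∫ p in K, s p ∂ν)) ^ 2 ≤ δ

variable {ν τ s} {m m' : Finset (Set (Pair d))} {K : Set (Pair d)} {J : ℕ} {δ : ℝ}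

/-- The test is antisymmetric, up to the nonnegative term `α H²`. -/
lemma neg_sum_partitionScore_le (m m' : Finset (Set (Pair d))) :
    -∑ K' ∈ m', partitionScore ν τ K' m ≤ ∑ K ∈ m, partitionScore ν τ K m' := by
  rw [neg_le_iff_add_nonneg]
  unfold partitionScore
  rw [Finset.sum_comm (s := m'), ← Finset.sum_add_distrib]
  refine Finset.sum_nonneg fun K _ => ?_
  rw [← Finset.sum_add_distrib]
  refine Finset.sum_nonneg fun K' _ => ?_
  rw [Set.inter_comm K' K]
  exact cellScore_add_swap_nonneg measureReal_nonneg _ _ _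

lemma sum_partitionScore_self_nonneg : 0 ≤ ∑ K ∈ m, partitionScore ν τ K m := by
  linarith [neg_sum_partitionScore_le (ν := ν) (τ := τ) m m]

lemma IsConcentrated.inter (h : IsConcentrated ν τ s J δ) (hd : 0 < d)
    (hm : IsDyadicPartition m) (hm' : IsDyadicPartition m') {K' : Set (Pair d)} (hK : K ∈ m)
    (hK' : K' ∈ m') (hJ : m.card + (join m' K).card ≤ J) (hne : (K ∩ K').Nonempty) :
    (√(τ.real (K ∩ K')) - √(∫ p in K ∩ K', s p ∂ν)) ^ 2 ≤ δ := by
  obtain ⟨a, ha⟩ := hm.exists_level K hK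
  obtain ⟨b, hb⟩ := hm'.exists_level K' hK'
  have ham := hm.level_le_card hd hK ha
  have hba := hm'.le_add_card_join hd ha hK' hb hne
  rcases hm.inter_eq_left_or_right hm' hK hK' hne with h' | h' <;> rw [h']
  · exact h a (by omega) K ha
  · exact h b (by omega) K' hb

variable [IsFiniteMeasure ν]

lemma histogramLoss_le [IsFiniteMeasure τ] (hs : ∀ p, 0 ≤ s p) (hint : Integrable s ν)
    (hm : IsDyadicPartition m) :
    histogramLoss ν τ s m ≤ ∫ p in unitSquare d, s p ∂ν + τ.real (unitSquare d) := by
  rw [← hm.sum_setIntegral hint, ← hm.sum_measureReal, ← Finset.sum_add_distrib]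
  refine Finset.sum_le_sum fun K _ => ?_
  rw [cellLoss_eq hs hint cellRatio_nonneg]
  have hcross : 0 ≤ 2 * √(cellRatio ν τ K) * ∫ p in K, √(s p) ∂ν :=
    mul_nonneg (by positivity) (integral_nonneg fun _ => Real.sqrt_nonneg _)
  linarith [cellRatio_mul_le (ν := ν) (τ := τ) (K := K)]

lemma partitionScore_le [IsFiniteMeasure τ] (hm' : IsDyadicPartition m') (hK : MeasurableSet K)
    (hKA : K ⊆ unitSquare d) : partitionScore ν τ K m' ≤ 5 * τ.real (unitSquare d) := by
  have hval (K' : Set (Pair d)) : 0 ≤ cellRatio ν τ K' := cellRatio_nonneg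
  have hsum : ∑ K' ∈ m', cellRatio ν τ K' * ν.real (K ∩ K') ≤ τ.real (unitSquare d) := by
    rw [← hm'.sum_measureReal]
    refine Finset.sum_le_sum fun K' _ => ?_
    exact (mul_le_mul_of_nonneg_left (measureReal_mono Set.inter_subset_right) (hval K')).trans
      cellRatio_mul_le
  calc partitionScore ν τ K m'
      ≤ ∑ K' ∈ m', (τ.real (K ∩ K') + 2 * (cellRatio ν τ K * ν.real (K ∩ K')
          + cellRatio ν τ K' * ν.real (K ∩ K'))) :=
        Finset.sum_le_sum fun K' _ =>
          cellScore_le (hval K) (hval K') measureReal_nonneg measureReal_nonneg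
    _ = τ.real K + 2 * (cellRatio ν τ K * ν.real K
          + ∑ K' ∈ m', cellRatio ν τ K' * ν.real (K ∩ K')) := by
        rw [Finset.sum_add_distrib, ← Finset.mul_sum, Finset.sum_add_distrib, ← Finset.mul_sum,
          hm'.sum_measureReal_inter hK hKA, hm'.sum_measureReal_inter hK hKA]
    _ ≤ 5 * τ.real (unitSquare d) := by
        linarith [cellRatio_mul_le (ν := ν) (τ := τ) (K := K),
          measureReal_mono (μ := τ) hKA]

lemma partitionScore_le_cellLoss (hs : ∀ p, 0 ≤ s p) (hint : Integrable s ν)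
    (hm' : IsDyadicPartition m') (hK : MeasurableSet K) (hKA : K ⊆ unitSquare d)
    (hδ : ∀ K' ∈ m', (K ∩ K').Nonempty →
      (√(τ.real (K ∩ K')) - √(∫ p in K ∩ K', s p ∂ν)) ^ 2 ≤ δ) :
    partitionScore ν τ K m' ≤ 2 * cellLoss ν s K (cellRatio ν τ K)
      - (∑ K' ∈ m', cellLoss ν s (K ∩ K') (cellRatio ν τ K')) / 60
      + 151 * δ * (join m' K).card := by
  classical
  have hsplit : cellLoss ν s K (cellRatio ν τ K) =
      ∑ K' ∈ m', cellLoss ν s (K ∩ K') (cellRatio ν τ K) :=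
    (hm'.sum_setIntegral_inter hK hKA (integrable_sqrt_sub_sq hs hint _)).symm
  rw [hsplit, hm'.card_join, Finset.card_filter, Nat.cast_sum, Finset.mul_sum, Finset.mul_sum,
    Finset.sum_div, ← Finset.sum_sub_distrib, ← Finset.sum_add_distrib]
  refine Finset.sum_le_sum fun K' hK' => ?_
  by_cases hne : (K ∩ K').Nonempty
  · rw [if_pos hne, Nat.cast_one, mul_one]
    exact cellScore_le_cellLoss hs hint cellRatio_nonneg cellRatio_nonneg (hδ K' hK' hne)
  · rw [if_neg hne, Set.not_nonempty_iff_eq_empty.mp hne]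
    simp [cellScore, cellLoss]

lemma IsConcentrated.sum_partitionScore_le (h : IsConcentrated ν τ s J δ) (hd : 0 < d)
    (hs : ∀ p, 0 ≤ s p) (hint : Integrable s ν) (hδ : 0 ≤ δ) (hm : IsDyadicPartition m)
    (hm' : IsDyadicPartition m') (hJ : m.card + m'.card ≤ J) :
    ∑ K ∈ m, partitionScore ν τ K m' ≤ 2 * histogramLoss ν τ s m - histogramLoss ν τ s m' / 60
      + 151 * δ * (m.card + m'.card) := by
  classical
  have hcard (K : Set (Pair d)) : (join m' K).card ≤ m'.card := by
    rw [hm'.card_join]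
    exact Finset.card_filter_le _ _
  have hloss : ∑ K ∈ m, ∑ K' ∈ m', cellLoss ν s (K ∩ K') (cellRatio ν τ K') =
      histogramLoss ν τ s m' := by
    rw [Finset.sum_comm]
    refine Finset.sum_congr rfl fun K' hK' => ?_
    simp only [Set.inter_comm _ K']
    exact hm.sum_setIntegral_inter (hm'.measurableSet hK') (hm'.subset hK')
      (integrable_sqrt_sub_sq hs hint _)
  have hjoin : ∑ K ∈ m, ((join m' K).card : ℝ) ≤ m.card + m'.card := by
    exact_mod_cast (hm.sum_card_join_le hm').trans (Finset.card_union_le m m')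
  calc ∑ K ∈ m, partitionScore ν τ K m'
      ≤ ∑ K ∈ m, (2 * cellLoss ν s K (cellRatio ν τ K)
          - (∑ K' ∈ m', cellLoss ν s (K ∩ K') (cellRatio ν τ K')) / 60
          + 151 * δ * (join m' K).card) :=
        Finset.sum_le_sum fun K hK => partitionScore_le_cellLoss hs hint hm'
          (hm.measurableSet hK) (hm.subset hK) fun K' hK' hne =>
            h.inter hd hm hm' hK hK' (by linarith [hcard K]) hne
    _ = 2 * histogramLoss ν τ s m - histogramLoss ν τ s m' / 60
          + 151 * δ * ∑ K ∈ m, ((join m' K).card : ℝ) := by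
        rw [Finset.sum_add_distrib, Finset.sum_sub_distrib, ← Finset.mul_sum, ← Finset.sum_div,
          hloss, ← Finset.mul_sum]
        rfl
    _ ≤ _ := by gcongr

lemma IsConcentrated.histogramLoss_le (h : IsConcentrated ν τ s J δ) (hd : 0 < d)
    (hs : ∀ p, 0 ≤ s p) (hint : Integrable s ν) (hm : IsDyadicPartition m) (hJ : m.card ≤ J)
    {a : Set (Pair d) → ℝ} (ha : ∀ K ∈ m, 0 ≤ a K) :
    histogramLoss ν τ s m ≤ 6 * ∑ K ∈ m, cellLoss ν s K (a K) + 4 * δ * m.card := by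
  calc histogramLoss ν τ s m
      ≤ ∑ K ∈ m, (6 * cellLoss ν s K (a K) + 4 * δ) :=
        Finset.sum_le_sum fun K hK =>
          let ⟨j, hj⟩ := hm.exists_level K hK
          cellLoss_cellRatio_le hs hint (ha K hK)
            (h j ((hm.level_le_card hd hK hj).trans hJ) K hj)
    _ = _ := by rw [Finset.sum_add_distrib, ← Finset.mul_sum, Finset.sum_const, nsmul_eq_mul,
          mul_comm (m.card : ℝ)]

end Partition

/-! ### The selection criterion -/

/-- A nonnegative measurable function whose sections have mass at most `1` on `[0,1]^d`: the
properties of the transition density that are used along a fixed path. -/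
structure IsSubdensity {d : ℕ} (μ : Measure (Fin d → ℝ)) (s : Pair d → ℝ) : Prop where
  measurable : Measurable s
  nonneg : ∀ p, 0 ≤ s p
  lintegral_le_one : ∀ z, ∫⁻ y in unitCube d, ENNReal.ofReal (s (z, y)) ∂μ ≤ 1

lemma IsMarkovChain.isSubdensity {Ω : Type*} [MeasurableSpace Ω] {P : Measure Ω} {d : ℕ}
    {μ : Measure (Fin d → ℝ)} {s : Pair d → ℝ} {X : ℕ → Ω → Fin d → ℝ}
    (h : IsMarkovChain P μ s X) : IsSubdensity μ s where
  measurable := h.measurable_density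
  nonneg := h.density_nonneg
  lintegral_le_one z := (setLIntegral_le_lintegral _ _).trans (h.lintegral_density z).le

section Loss

variable {d n : ℕ} {μ : Measure (Fin d → ℝ)} {s : Pair d → ℝ} {x : ℕ → Fin d → ℝ}
  {m : Finset (Set (Pair d))}

namespace IsSubdensity

lemma integrable_section (hs : IsSubdensity μ s) (z : Fin d → ℝ) :
    Integrable (fun y => s (z, y)) (μ.restrict (unitCube d)) := by
  refine ⟨(hs.measurable.comp measurable_prodMk_left).aestronglyMeasurable, ?_⟩
  rw [hasFiniteIntegral_iff_ofReal (ae_of_all _ fun y => hs.nonneg _)]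
  exact (hs.lintegral_le_one z).trans_lt ENNReal.one_lt_top

lemma setIntegral_section_le_one (hs : IsSubdensity μ s) (z : Fin d → ℝ) :
    ∫ y in unitCube d, s (z, y) ∂μ ≤ 1 := by
  rw [integral_eq_lintegral_of_nonneg_ae (ae_of_all _ fun y => hs.nonneg _)
    (hs.measurable.comp measurable_prodMk_left).aestronglyMeasurable]
  exact ENNReal.toReal_le_of_le_ofReal zero_le_one
    ((hs.lintegral_le_one z).trans_eq ENNReal.ofReal_one.symm)

lemma integrable_occupation (hs : IsSubdensity μ s) : Integrable s (occupation μ n x) :=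
  TransitionDensity.integrable_occupation hs.measurable fun i => hs.integrable_section (x i)

lemma integral_occupation_le (hs : IsSubdensity μ s) : ∫ p, s p ∂occupation μ n x ≤ n := by
  rw [integral_occupation hs.measurable hs.integrable_occupation]
  calc ∑ i ∈ Finset.range n, ∫ y in unitCube d, s (x i, y) ∂μ
      ≤ ∑ _i ∈ Finset.range n, (1 : ℝ) :=
        Finset.sum_le_sum fun i _ => hs.setIntegral_section_le_one (x i)
    _ = n := by simp

lemma setIntegral_occupation_le (hs : IsSubdensity μ s) (K : Set (Pair d)) :
    ∫ p in K, s p ∂occupation μ n x ≤ n :=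
  (setIntegral_le_integral hs.integrable_occupation (ae_of_all _ hs.nonneg)).trans
    hs.integral_occupation_le

end IsSubdensity

lemma hellingerSq_nonneg (f g : Pair d → ℝ) : 0 ≤ hellingerSq μ n x f g :=
  mul_nonneg (by positivity)
    (Finset.sum_nonneg fun _ _ => integral_nonneg fun _ => sq_nonneg _)

lemma hellingerSqDist_nonneg (f : Pair d → ℝ) (V : Set (Pair d → ℝ)) :
    0 ≤ hellingerSqDist μ n x f V :=
  Real.iInf_nonneg fun _ => hellingerSq_nonneg _ _

lemma hellingerSqDist_le_hellingerSq (f : Pair d → ℝ) {V : Set (Pair d → ℝ)} {g : Pair d → ℝ}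
    (hg : g ∈ V) : hellingerSqDist μ n x f V ≤ hellingerSq μ n x f g :=
  ciInf_le (f := fun g : V => hellingerSq μ n x f g)
    ⟨0, Set.forall_mem_range.mpr fun _ => hellingerSq_nonneg _ _⟩ ⟨g, hg⟩

variable [IsFiniteMeasure (μ.restrict (unitCube d))]

lemma hellingerSq_indicator_sum (hs : IsSubdensity μ s) (hm : IsDyadicPartition m)
    (a : Set (Pair d) → ℝ) :
    hellingerSq μ n x ((unitSquare d).indicator s)
        (fun p => ∑ K ∈ m, a K * K.indicator (fun _ => (1 : ℝ)) p) =
      1 / (2 * n) * ∑ K ∈ m, cellLoss (occupation μ n x) s K (a K) := by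
  set f : Pair d → ℝ := fun p =>
    (√(s p) - √(∑ K ∈ m, a K * K.indicator (fun _ => (1 : ℝ)) p)) ^ 2 with hf_def
  have hf : Measurable f := ((hs.measurable.sqrt).sub (Finset.measurable_sum _ fun K hK =>
    (measurable_const.indicator (hm.measurableSet hK)).const_mul _).sqrt).pow_const 2
  have hindicator : ∀ p, (√((unitSquare d).indicator s p) -
      √(∑ K ∈ m, a K * K.indicator (fun _ => (1 : ℝ)) p)) ^ 2 = (unitSquare d).indicator f p := by
    intro p
    by_cases hp : p ∈ unitSquare d
    · simp only [hf_def, Set.indicator_of_mem hp]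
    · have : ∀ K ∈ m, a K * K.indicator (fun _ => (1 : ℝ)) p = 0 := fun K hK => by
        rw [Set.indicator_of_notMem fun h => hp (hm.subset hK h), mul_zero]
      simp [Set.indicator_of_notMem hp, Finset.sum_eq_zero this]
  have hcell : ∀ K ∈ m, Set.EqOn f (fun p => (√(s p) - √(a K)) ^ 2) K := fun K hK p hp => by
    simp only [hf_def, hm.sum_mul_indicator a hK hp]
  have hint : ∀ K ∈ m, IntegrableOn f K (occupation μ n x) := fun K hK =>
    (integrableOn_congr_fun (hcell K hK) (hm.measurableSet hK)).mpr
      (integrable_sqrt_sub_sq hs.nonneg hs.integrable_occupation _).integrableOn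
  have hintA : IntegrableOn f (unitSquare d) (occupation μ n x) := by
    rw [← hm.biUnion_eq]
    exact integrableOn_finset_iUnion.mpr hint
  simp only [hellingerSq, hindicator]
  rw [sum_integral_indicator measurableSet_unitSquare subset_rfl hf hintA, ← hm.biUnion_eq,
    integral_biUnion_finset m (fun K hK => hm.measurableSet hK) hm.pairwiseDisjoint hint]
  congr 1
  exact Finset.sum_congr rfl fun K hK => setIntegral_congr_fun (hm.measurableSet hK) (hcell K hK)

lemma hellingerSq_histogramEstimator (hs : IsSubdensity μ s) (hm : IsDyadicPartition m) :
    hellingerSq μ n x ((unitSquare d).indicator s) (histogramEstimator μ n x m) =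
      1 / (2 * n) * histogramLoss (occupation μ n x) (transitions n x) s m := by
  rw [funext (histogramEstimator_eq hm), hellingerSq_indicator_sum hs hm]
  rfl

lemma hellingerSq_histogramEstimator_le_one (hs : IsSubdensity μ s) (hm : IsDyadicPartition m) :
    hellingerSq μ n x ((unitSquare d).indicator s) (histogramEstimator μ n x m) ≤ 1 := by
  have hmass := hs.setIntegral_occupation_le (n := n) (x := x) (unitSquare d)
  have hloss := histogramLoss_le (τ := transitions n x) hs.nonneg
    (hs.integrable_occupation (n := n) (x := x)) hm
  have hcount := transitions_real_le (n := n) (x := x) (measurableSet_unitSquare (d := d))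
  rw [hellingerSq_histogramEstimator hs hm, one_div_mul_eq_div]
  exact div_le_one_of_le₀ (by linarith) (by positivity)

lemma hellingerSqDist_histograms (hs : IsSubdensity μ s) (hm : IsDyadicPartition m) :
    hellingerSqDist μ n x ((unitSquare d).indicator s) (histograms m) =
      1 / (2 * n) * ∑ K ∈ m, cellLoss (occupation μ n x) s K
        (((∫ p in K, √(s p) ∂occupation μ n x) / (occupation μ n x).real K) ^ 2) := by
  rw [← hellingerSq_indicator_sum hs hm]
  refine le_antisymm (hellingerSqDist_le_hellingerSq _ ⟨_, fun _ _ => sq_nonneg _, rfl⟩) ?_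
  have : Nonempty (histograms m) := ⟨⟨_, 0, fun _ _ => le_rfl, rfl⟩⟩
  refine le_ciInf fun g => ?_
  obtain ⟨_, a, ha, rfl⟩ := g
  rw [hellingerSq_indicator_sum hs hm, hellingerSq_indicator_sum hs hm]
  gcongr with K hK
  exact cellLoss_sq_div_le hs.nonneg hs.integrable_occupation (ha K hK)

lemma hellingerSqDist_histograms_le_one (hs : IsSubdensity μ s) (hm : IsDyadicPartition m) :
    hellingerSqDist μ n x ((unitSquare d).indicator s) (histograms m) ≤ 1 := by
  have hmem : histogramEstimator μ n x m ∈ histograms m :=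
    ⟨_, fun _ _ => cellRatio_nonneg, funext (histogramEstimator_eq hm)⟩
  exact (hellingerSqDist_le_hellingerSq _ hmem).trans
    (hellingerSq_histogramEstimator_le_one hs hm)

end Loss

section Criterion

variable {d n : ℕ} {μ : Measure (Fin d → ℝ)} {s : Pair d → ℝ} {x : ℕ → Fin d → ℝ}
  {m m' : Finset (Set (Pair d))} {K : Set (Pair d)} {L : ℝ} {ℓ : ℕ∞}

lemma pen_nonneg (hL : 0 ≤ L) (m : Finset (Set (Pair d))) : 0 ≤ pen L n m := by
  have := Real.log_natCast_nonneg n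
  unfold pen
  positivity

lemma one_le_log_natCast (hn : 3 < n) : 1 ≤ Real.log n := by
  have hn' : (4 : ℝ) ≤ n := by exact_mod_cast hn
  rw [Real.le_log_iff_exp_le (by linarith)]
  linarith [Real.exp_one_lt_d9]

lemma le_pen_of_le_card (hn : 3 < n) (hL : 0 ≤ L) (hm : n ≤ m.card) : L ≤ pen L n m := by
  have hn' : (0 : ℝ) < n := by positivity
  have hlog := one_le_log_natCast hn
  refine le_mul_of_one_le_right hL ((one_le_div₀ hn').mpr ?_)
  exact (Nat.cast_le.mpr hm).trans (le_mul_of_one_le_right (Nat.cast_nonneg _) hlog)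

lemma sum_pen_join_le [DecidableEq (Set (Pair d))] (hL : 0 ≤ L) (hm : IsDyadicPartition m)
    (hm' : IsDyadicPartition m') : ∑ K ∈ m, pen L n (join m' K) ≤ pen L n (m ∪ m') := by
  have hcard : ∑ K ∈ m, ((join m' K).card : ℝ) ≤ (m ∪ m').card := by
    exact_mod_cast hm.sum_card_join_le hm'
  have := Real.log_natCast_nonneg n
  unfold pen
  rw [← Finset.mul_sum, ← Finset.sum_div, ← Finset.sum_mul]
  gcongr

lemma pen_union_le [DecidableEq (Set (Pair d))] (hL : 0 ≤ L) :
    pen L n (m ∪ m') ≤ pen L n m + pen L n m' := by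
  have hcard : ((m ∪ m').card : ℝ) ≤ m.card + m'.card := by
    exact_mod_cast Finset.card_union_le m m'
  have := Real.log_natCast_nonneg n
  unfold pen
  rw [← mul_add, ← add_div, ← add_mul]
  gcongr

variable [IsFiniteMeasure (μ.restrict (unitCube d))]

lemma criterion_eq (hm : IsDyadicPartition m) : criterion μ n L ℓ x m =
    (∑ K ∈ m, ⨆ m' : partitions d ℓ,
      (1 / n * partitionScore (occupation μ n x) (transitions n x) K m'.1
        - pen L n (join m'.1 K))) + 2 * pen L n m := by
  unfold criterion
  congr 1
  refine Finset.sum_congr rfl fun K hK => ?_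
  congr 1
  ext m'
  have hm' := IsDyadicPartition.of_mem_partitions m'.2
  congr 1
  unfold partitionScore
  rw [Finset.mul_sum]
  refine Finset.sum_congr rfl fun K' hK' => ?_
  rw [indicator_histogramEstimator hm hK Set.inter_subset_left,
    indicator_histogramEstimator hm' hK' Set.inter_subset_right,
    alpha_mul_hellingerSq_add_testT ((hm.measurableSet hK).inter (hm'.measurableSet hK'))
      (Set.inter_subset_left.trans (hm.subset hK))]

lemma partitionScore_div_le (hm' : IsDyadicPartition m') (hK : MeasurableSet K)
    (hKA : K ⊆ unitSquare d) :
    1 / n * partitionScore (occupation μ n x) (transitions n x) K m' ≤ 5 := by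
  have hscore := partitionScore_le (ν := occupation μ n x) (τ := transitions n x) hm' hK hKA
  have hcount := transitions_real_le (n := n) (x := x) (measurableSet_unitSquare (d := d))
  rw [one_div_mul_eq_div]
  exact div_le_of_le_mul₀ (Nat.cast_nonneg _) (by norm_num) (by linarith)

lemma partitionScore_sub_pen_le (hL : 0 ≤ L) (hm : IsDyadicPartition m) (hK : K ∈ m)
    (m' : partitions d ℓ) :
    1 / n * partitionScore (occupation μ n x) (transitions n x) K m'.1 - pen L n (join m'.1 K)
      ≤ 5 :=
  (sub_le_self _ (pen_nonneg hL _)).trans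
    (partitionScore_div_le (.of_mem_partitions m'.2) (hm.measurableSet hK) (hm.subset hK))

lemma le_criterion (hL : 0 ≤ L) (hm : IsDyadicPartition m) (hm' : m' ∈ partitions d ℓ) :
    1 / n * ∑ K ∈ m, partitionScore (occupation μ n x) (transitions n x) K m'
        - ∑ K ∈ m, pen L n (join m' K) + 2 * pen L n m
      ≤ criterion μ n L ℓ x m := by
  rw [criterion_eq hm, Finset.mul_sum, ← Finset.sum_sub_distrib]
  gcongr with K hK
  exact le_ciSup (f := fun m' : partitions d ℓ =>
      1 / n * partitionScore (occupation μ n x) (transitions n x) K m'.1 - pen L n (join m'.1 K))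
    ⟨5, Set.forall_mem_range.mpr (partitionScore_sub_pen_le hL hm hK)⟩ ⟨m', hm'⟩

lemma pen_sub_pen_sub_le_criterion (hL : 0 ≤ L) (hm : IsDyadicPartition m)
    (hm' : m' ∈ partitions d ℓ) :
    pen L n m - pen L n m'
        - 1 / n * ∑ K ∈ m', partitionScore (occupation μ n x) (transitions n x) K m
      ≤ criterion μ n L ℓ x m := by
  classical
  have hjoin := (sum_pen_join_le (n := n) hL hm (.of_mem_partitions hm')).trans (pen_union_le hL)
  have hswap := mul_le_mul_of_nonneg_left (neg_sum_partitionScore_le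
    (ν := occupation μ n x) (τ := transitions n x) m m') (by positivity : 0 ≤ 1 / (n : ℝ))
  linarith [le_criterion (μ := μ) (x := x) (n := n) hL hm hm']

lemma pen_le_criterion (hL : 0 ≤ L) (hm : m ∈ partitions d ℓ) :
    pen L n m ≤ criterion μ n L ℓ x m := by
  classical
  have hP := IsDyadicPartition.of_mem_partitions hm
  have hjoin := sum_pen_join_le (n := n) hL hP hP
  rw [Finset.union_idempotent] at hjoin
  have hself : 0 ≤ 1 / (n : ℝ) *
      ∑ K ∈ m, partitionScore (occupation μ n x) (transitions n x) K m :=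
    mul_nonneg (by positivity) sum_partitionScore_self_nonneg
  linarith [le_criterion (μ := μ) (x := x) (n := n) hL hP hm]

lemma criterion_le_add_of_le_iInf (hL : 0 ≤ L) {c : ℝ} {mhat : Finset (Set (Pair d))}
    (hsel : criterion μ n L ℓ x mhat ≤ (⨅ m : partitions d ℓ, criterion μ n L ℓ x m.1) + c)
    (hm : m ∈ partitions d ℓ) : criterion μ n L ℓ x mhat ≤ criterion μ n L ℓ x m + c := by
  refine hsel.trans (add_le_add_left (ciInf_le (f := fun m : partitions d ℓ =>
    criterion μ n L ℓ x m.1) ⟨0, Set.forall_mem_range.mpr fun m => ?_⟩ ⟨m, hm⟩) c)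
  exact (pen_nonneg hL _).trans (pen_le_criterion hL m.2)

lemma criterion_singleton_le (hL : 0 ≤ L) :
    criterion μ n L ℓ x {unitSquare d} ≤ 5 + 2 * pen L n {unitSquare d} := by
  rw [criterion_eq .singleton, Finset.sum_singleton]
  have : Nonempty (partitions d ℓ) := ⟨⟨_, singleton_mem_partitions d ℓ⟩⟩
  gcongr
  exact ciSup_le fun m' =>
    partitionScore_sub_pen_le hL .singleton (Finset.mem_singleton_self _) m'

lemma card_le_of_criterion_le (hn : 3 < n) (hL : 12 ≤ L) (hm : m ∈ partitions d ℓ)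
    (hsel : criterion μ n L ℓ x m ≤ criterion μ n L ℓ x {unitSquare d} + 1 / n) :
    m.card ≤ n := by
  have hn' : (4 : ℝ) ≤ n := by exact_mod_cast hn
  have hinv : 1 / (n : ℝ) ≤ 1 := div_le_one_of_le₀ (by linarith) (by linarith)
  have hpen : pen L n m ≤ 6 + 2 * pen L n {unitSquare d} := by
    linarith [pen_le_criterion (μ := μ) (x := x) (n := n) (L := L) (by linarith) hm,
      criterion_singleton_le (μ := μ) (n := n) (L := L) (ℓ := ℓ) (x := x) (by linarith)]
  have hmul : 12 ≤ L * Real.log n := by nlinarith [one_le_log_natCast hn]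
  unfold pen at hpen
  rw [Finset.card_singleton, Nat.cast_one, one_mul] at hpen
  have hmain : L * Real.log n * (m.card - 2) ≤ 6 * n := by
    field_simp at hpen
    linarith
  by_contra! hcard
  have hcard' : (n : ℝ) + 1 ≤ m.card := by exact_mod_cast hcard
  nlinarith

end Criterion

/-! ### The oracle inequality along a good path -/

section Oracle

variable {d n : ℕ} {μ : Measure (Fin d → ℝ)} {s : Pair d → ℝ} {x : ℕ → Fin d → ℝ}
  {m mhat : Finset (Set (Pair d))} {L : ℝ} {ℓ : ℕ∞}

/-- A path along which the number of transitions in each dyadic cube of level at most `2n` deviates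
from its compensator by at most the amount that the penalty can absorb. -/
def IsGoodPath (μ : Measure (Fin d → ℝ)) (s : Pair d → ℝ) (n : ℕ) (x : ℕ → Fin d → ℝ) : Prop :=
  IsConcentrated (occupation μ n x) (transitions n x) s (2 * n) (36 * Real.log n)

lemma mul_log_mul_card_le_pen {c : ℝ} (hc : c ≤ L) (m : Finset (Set (Pair d))) :
    1 / n * (c * Real.log n * m.card) ≤ pen L n m := by
  have := Real.log_natCast_nonneg n
  calc 1 / n * (c * Real.log n * m.card) = c * (m.card * Real.log n / n) := by ring
    _ ≤ pen L n m := by unfold pen; gcongr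

variable [IsFiniteMeasure (μ.restrict (unitCube d))]

lemma IsGoodPath.partitionScore_sub_pen_le (hgood : IsGoodPath μ s n x) (hd : 0 < d)
    (hn : 3 < n) (hs : IsSubdensity μ s) (hL : 5436 ≤ L) (hm : IsDyadicPartition m)
    (hmn : m.card ≤ n) {m' : Finset (Set (Pair d))} (hm' : IsDyadicPartition m')
    {K : Set (Pair d)} (hK : K ∈ m) :
    1 / n * partitionScore (occupation μ n x) (transitions n x) K m' - pen L n (join m' K) ≤
      1 / n * (2 * cellLoss (occupation μ n x) s K
        (cellRatio (occupation μ n x) (transitions n x) K)) := by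
  have hloss := cellLoss_nonneg (ν := occupation μ n x) (s := s) (K := K)
  rcases le_or_gt (join m' K).card n with hcard | hcard
  · have hscore := partitionScore_le_cellLoss hs.nonneg hs.integrable_occupation hm'
      (hm.measurableSet hK) (hm.subset hK) fun K' hK' hne =>
        hgood.inter hd hm hm' hK hK' (by omega) hne
    have hscore' := mul_le_mul_of_nonneg_left (hscore.trans (add_le_add_left
      (sub_le_self _ (div_nonneg (Finset.sum_nonneg fun _ _ => cellLoss_nonneg _) (by norm_num)))
      _)) (by positivity : 0 ≤ 1 / (n : ℝ))
    linarith [mul_log_mul_card_le_pen (n := n) hL (join m' K)]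
  · have hpen := le_pen_of_le_card hn (by linarith) hcard.le
    have hscore := partitionScore_div_le (μ := μ) (n := n) (x := x) hm' (hm.measurableSet hK)
      (hm.subset hK)
    have : 0 ≤ 1 / n * (2 * cellLoss (occupation μ n x) s K
        (cellRatio (occupation μ n x) (transitions n x) K)) :=
      mul_nonneg (by positivity) (mul_nonneg zero_le_two (hloss _))
    linarith

lemma IsGoodPath.criterion_le (hgood : IsGoodPath μ s n x) (hd : 0 < d) (hn : 3 < n)
    (hs : IsSubdensity μ s) (hL : 5436 ≤ L) (hm : IsDyadicPartition m) (hmn : m.card ≤ n) :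
    criterion μ n L ℓ x m ≤
      1 / n * (2 * histogramLoss (occupation μ n x) (transitions n x) s m) + 2 * pen L n m := by
  have : Nonempty (partitions d ℓ) := ⟨⟨_, singleton_mem_partitions d ℓ⟩⟩
  unfold histogramLoss
  rw [criterion_eq hm, Finset.mul_sum, Finset.mul_sum]
  gcongr with K hK
  exact ciSup_le fun m' => hgood.partitionScore_sub_pen_le hd hn hs hL hm hmn
    (.of_mem_partitions m'.2) hK

lemma IsGoodPath.histogramLoss_le_add_pen (hgood : IsGoodPath μ s n x) (hd : 0 < d) (hn : 3 < n)
    (hs : IsSubdensity μ s) (hL : 5437 ≤ L) (hm : m ∈ partitions d ℓ)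
    (hmn : m.card ≤ n) (hmhat : IsDyadicPartition mhat) (hmhatn : mhat.card ≤ n)
    (hsel : criterion μ n L ℓ x mhat ≤ criterion μ n L ℓ x m + 1 / n) :
    1 / n * histogramLoss (occupation μ n x) (transitions n x) s mhat ≤
      60 * (4 * (1 / n * histogramLoss (occupation μ n x) (transitions n x) s m)
        + 4 * pen L n m) := by
  have hP := IsDyadicPartition.of_mem_partitions hm
  have hscore := mul_le_mul_of_nonneg_left (IsConcentrated.sum_partitionScore_le hgood hd hs.nonneg
    hs.integrable_occupation (by positivity) hP hmhat (by omega)) (by positivity : 0 ≤ 1 / (n : ℝ))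
  have hlow := pen_sub_pen_sub_le_criterion (μ := μ) (x := x) (n := n) (by linarith : 0 ≤ L)
    hmhat hm
  have hup := hgood.criterion_le (ℓ := ℓ) hd hn hs (by linarith : 5436 ≤ L) hP hmn
  have hone : 1 / (n : ℝ) ≤ 1 / n * (1 * Real.log n * m.card) := by
    have : (1 : ℝ) ≤ m.card := Nat.one_le_cast.mpr hP.card_pos
    exact le_mul_of_one_le_right (by positivity) (by nlinarith [one_le_log_natCast hn])
  have hpen := mul_log_mul_card_le_pen (n := n) hL m
  have hpenhat := mul_log_mul_card_le_pen (n := n) (by linarith : 5436 ≤ L) mhat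
  linarith

lemma IsGoodPath.hellingerSq_le (hgood : IsGoodPath μ s n x) (hd : 0 < d) (hn : 3 < n)
    (hs : IsSubdensity μ s) (hL : 6000 ≤ L) (hm : m ∈ partitions d ℓ)
    (hmn : m.card ≤ n) (hmhat : mhat ∈ partitions d ℓ)
    (hsel : criterion μ n L ℓ x mhat ≤
      (⨅ m' : partitions d ℓ, criterion μ n L ℓ x m'.1) + 1 / n) :
    hellingerSq μ n x ((unitSquare d).indicator s) (histogramEstimator μ n x mhat) ≤
      1440 * (hellingerSqDist μ n x ((unitSquare d).indicator s) (histograms m) + pen L n m) := by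
  have hP := IsDyadicPartition.of_mem_partitions hm
  have hPhat := IsDyadicPartition.of_mem_partitions hmhat
  have hcrit {m'} (hm' : m' ∈ partitions d ℓ) :=
    criterion_le_add_of_le_iInf (by linarith : 0 ≤ L) hsel hm'
  have hmhatn := card_le_of_criterion_le hn (by linarith) hmhat
    (hcrit (singleton_mem_partitions d ℓ))
  have hselected := hgood.histogramLoss_le_add_pen hd hn hs (by linarith) hm hmn
    hPhat hmhatn (hcrit hm)
  have horacle := mul_le_mul_of_nonneg_left (IsConcentrated.histogramLoss_le hgood hd hs.nonneg
    hs.integrable_occupation hP (by omega) fun K _ => sq_nonneg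
      ((∫ p in K, √(s p) ∂occupation μ n x) / (occupation μ n x).real K))
    (by positivity : 0 ≤ 1 / (n : ℝ))
  have hpen := mul_log_mul_card_le_pen (n := n) (by linarith : 144 ≤ L) m
  have hpen_nonneg := pen_nonneg (n := n) (by linarith : 0 ≤ L) m
  have hhalf : 1 / (2 * (n : ℝ)) = 1 / n / 2 := by ring
  rw [hellingerSq_histogramEstimator hs hPhat, hellingerSqDist_histograms hs hP, hhalf]
  linarith

end Oracle

/-! ### Deviations of sums of Bernoulli trials -/

lemma exists_nat_lt_abs_sub {a b t : ℝ} {n : ℕ} (ha : 0 ≤ a) (hb : 0 ≤ b) (ht : 0 < t)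
    (hn : 0 < n) (hbn : b ≤ n ^ 2 * t) (h : 9 * t < (√a - √b) ^ 2) :
    ∃ k ∈ Finset.Icc 1 n, b / k + k * t < |a - b| := by
  set r := √(b / t) with hr
  have hrn : r ≤ n := Real.sqrt_le_iff.mpr ⟨n.cast_nonneg, (div_le_iff₀ ht).mpr hbn⟩
  have hb_eq : b = r ^ 2 * t := by rw [hr, Real.sq_sqrt (by positivity), div_mul_cancel₀ _ ht.ne']
  have habs : |a - b| = |√a - √b| * (√a + √b) := by
    rw [← abs_of_nonneg (by positivity : 0 ≤ √a + √b), ← abs_mul, mul_comm, ← sq_sub_sq,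
      Real.sq_sqrt ha, Real.sq_sqrt hb]
  have hroot : 3 * √t < |√a - √b| := by
    rw [← abs_of_nonneg (by positivity : 0 ≤ 3 * √t), ← sq_lt_sq, mul_pow, Real.sq_sqrt ht.le]
    linarith
  have hroot_b : √b = r * √t := by
    rw [hb_eq, Real.sqrt_mul (sq_nonneg r), Real.sqrt_sq (Real.sqrt_nonneg _)]
  have ht_eq : √t * √t = t := Real.mul_self_sqrt ht.le
  have : 0 < √t := Real.sqrt_pos.mpr ht
  rcases le_or_gt r 1 with hr1 | hr1
  · refine ⟨1, Finset.mem_Icc.mpr ⟨le_rfl, hn⟩, ?_⟩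
    have hlower : |√a - √b| ≤ √a + √b :=
      abs_sub_le_iff.mpr ⟨by linarith [Real.sqrt_nonneg b], by linarith [Real.sqrt_nonneg a]⟩
    have : b ≤ t := by
      rw [hb_eq]
      exact mul_le_of_le_one_left ht.le (pow_le_one₀ (by positivity) hr1)
    have : (3 * √t) * (3 * √t) < |a - b| := by
      rw [habs]; exact mul_lt_mul'' hroot (hroot.trans_le hlower) (by positivity) (by positivity)
    simp only [Nat.cast_one, div_one, one_mul]
    linarith
  · have hceil : (⌈r⌉₊ : ℝ) < r + 1 := Nat.ceil_lt_add_one (by linarith)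
    have hle : r ≤ ⌈r⌉₊ := Nat.le_ceil r
    refine ⟨⌈r⌉₊, Finset.mem_Icc.mpr ⟨Nat.ceil_pos.mpr (by linarith), Nat.ceil_le.mpr hrn⟩, ?_⟩
    calc b / ⌈r⌉₊ + ⌈r⌉₊ * t ≤ b / r + (2 * r) * t := by gcongr; linarith
      _ = (3 * √t) * (r * √t) := by rw [hb_eq]; field_simp; linarith
      _ < |√a - √b| * (√a + √b) :=
        mul_lt_mul hroot (by linarith [Real.sqrt_nonneg a]) (by positivity) (abs_nonneg _)
      _ = |a - b| := habs.symm

section BernoulliTrials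

variable {Ω : Type*} [mΩ : MeasurableSpace Ω]

/-- Trials `ξ i` with values in `{0, 1}`, revealed at time `i + 1`, whose probability of success
given the past `ℱ i` is `p i`. -/
structure IsBernoulliTrials (P : Measure Ω) (ℱ : Filtration ℕ mΩ) (ξ p : ℕ → Ω → ℝ) : Prop where
  eq_zero_or_one : ∀ i ω, ξ i ω = 0 ∨ ξ i ω = 1
  measurable_trial : ∀ i, Measurable[ℱ (i + 1)] (ξ i)
  measurable_probability : ∀ i, Measurable[ℱ i] (p i)
  probability_mem : ∀ i ω, p i ω ∈ Set.Icc 0 1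
  condExp_eq : ∀ i, P[ξ i | ℱ i] =ᵐ[P] p i

/-- The logarithm of the exponential supermartingale with parameter `l` of the trials `ξ` with
probabilities of success `p`. -/
def logSupermartingale (ξ p : ℕ → Ω → ℝ) (l : ℝ) (k : ℕ) (ω : Ω) : ℝ :=
  l * ∑ i ∈ Finset.range k, ξ i ω - (Real.exp l - 1) * ∑ i ∈ Finset.range k, p i ω

namespace IsBernoulliTrials

variable {P : Measure Ω} {ℱ : Filtration ℕ mΩ} {ξ p : ℕ → Ω → ℝ}

lemma trial_mem (h : IsBernoulliTrials P ℱ ξ p) (i : ℕ) (ω : Ω) : ξ i ω ∈ Set.Icc 0 1 := by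
  rcases h.eq_zero_or_one i ω with h' | h' <;> simp [h']

lemma measurable_sum_trial (h : IsBernoulliTrials P ℱ ξ p) (k : ℕ) :
    Measurable[ℱ k] fun ω => ∑ i ∈ Finset.range k, ξ i ω :=
  Finset.measurable_sum _ fun i hi =>
    (h.measurable_trial i).mono (ℱ.mono (Finset.mem_range.mp hi)) le_rfl

lemma measurable_sum_probability (h : IsBernoulliTrials P ℱ ξ p) (k : ℕ) :
    Measurable[ℱ k] fun ω => ∑ i ∈ Finset.range k, p i ω :=
  Finset.measurable_sum _ fun i hi =>
    (h.measurable_probability i).mono (ℱ.mono (Finset.mem_range.mp hi).le) le_rfl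

lemma measurable_logSupermartingale (h : IsBernoulliTrials P ℱ ξ p) (l : ℝ) (k : ℕ) :
    Measurable[ℱ k] (logSupermartingale ξ p l k) :=
  ((h.measurable_sum_trial k).const_mul l).sub
    ((h.measurable_sum_probability k).const_mul (Real.exp l - 1))

lemma exp_mul_trial (h : IsBernoulliTrials P ℱ ξ p) (l : ℝ) (i : ℕ) (ω : Ω) :
    Real.exp (l * ξ i ω) = 1 + (Real.exp l - 1) * ξ i ω := by
  rcases h.eq_zero_or_one i ω with h' | h' <;> simp [h']

lemma exp_logSupermartingale_succ (h : IsBernoulliTrials P ℱ ξ p) (l : ℝ) (k : ℕ) (ω : Ω) :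
    Real.exp (logSupermartingale ξ p l (k + 1) ω) =
      Real.exp (logSupermartingale ξ p l k ω) * Real.exp (-((Real.exp l - 1) * p k ω)) *
        (1 + (Real.exp l - 1) * ξ k ω) := by
  rw [← h.exp_mul_trial, ← Real.exp_add, ← Real.exp_add]
  congr 1
  simp only [logSupermartingale, Finset.sum_range_succ]
  ring

lemma neg_logSupermartingale_le (h : IsBernoulliTrials P ℱ ξ p) (l : ℝ) (k : ℕ) (ω : Ω) :
    -logSupermartingale ξ p l k ω ≤ |l| * ∑ i ∈ Finset.range k, ξ i ω +
      |Real.exp l - 1| * ∑ i ∈ Finset.range k, p i ω := by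
  have := mul_le_mul_of_nonneg_right (neg_abs_le l)
    (Finset.sum_nonneg fun i (_ : i ∈ Finset.range k) => (h.trial_mem i ω).1)
  have := mul_le_mul_of_nonneg_right (le_abs_self (Real.exp l - 1))
    (Finset.sum_nonneg fun i (_ : i ∈ Finset.range k) => (h.probability_mem i ω).1)
  unfold logSupermartingale
  linarith

variable [IsProbabilityMeasure P]

lemma integrable_trial (h : IsBernoulliTrials P ℱ ξ p) (i : ℕ) : Integrable (ξ i) P :=
  .of_mem_Icc 0 1 ((h.measurable_trial i).mono (ℱ.le _) le_rfl).aemeasurable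
    (ae_of_all _ (h.trial_mem i))

lemma integrable_probability (h : IsBernoulliTrials P ℱ ξ p) (i : ℕ) : Integrable (p i) P :=
  .of_mem_Icc 0 1 ((h.measurable_probability i).mono (ℱ.le _) le_rfl).aemeasurable
    (ae_of_all _ (h.probability_mem i))

lemma integral_mul_trial (h : IsBernoulliTrials P ℱ ξ p) (i : ℕ) {G : Ω → ℝ}
    (hG : Measurable[ℱ i] G) (hint : Integrable G P) :
    ∫ ω, G ω * ξ i ω ∂P = ∫ ω, G ω * p i ω ∂P := by
  have hGξ : Integrable (G * ξ i) P := hint.mul_bdd (c := 1)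
    (h.integrable_trial i).aestronglyMeasurable (ae_of_all _ fun ω =>
      (Real.norm_of_nonneg (h.trial_mem i ω).1).trans_le (h.trial_mem i ω).2)
  calc ∫ ω, G ω * ξ i ω ∂P = ∫ ω, (P[G * ξ i | ℱ i]) ω ∂P := (integral_condExp (ℱ.le i)).symm
    _ = ∫ ω, G ω * p i ω ∂P := by
      refine integral_congr_ae ?_
      filter_upwards [condExp_mul_of_stronglyMeasurable_left hG.stronglyMeasurable hGξ
        (h.integrable_trial i), h.condExp_eq i] with ω hpull hcond
      rw [hpull, Pi.mul_apply, hcond]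

lemma integral_trial (h : IsBernoulliTrials P ℱ ξ p) (i : ℕ) :
    ∫ ω, ξ i ω ∂P = ∫ ω, p i ω ∂P := by
  simpa using h.integral_mul_trial i measurable_const (integrable_const (1 : ℝ))

lemma integrable_exp_logSupermartingale (h : IsBernoulliTrials P ℱ ξ p) (l : ℝ) (k : ℕ) :
    Integrable (fun ω => Real.exp (logSupermartingale ξ p l k ω)) P := by
  refine Integrable.of_bound
    ((h.measurable_logSupermartingale l k).mono (ℱ.le k) le_rfl).exp.aestronglyMeasurable
    (Real.exp (|l| * k + |Real.exp l - 1| * k)) (ae_of_all _ fun ω => ?_)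
  have hsum {q : ℕ → Ω → ℝ} (hq : ∀ i ω, q i ω ∈ Set.Icc 0 1) :
      |∑ i ∈ Finset.range k, q i ω| ≤ k := by
    calc |∑ i ∈ Finset.range k, q i ω| ≤ ∑ i ∈ Finset.range k, |q i ω| :=
          Finset.abs_sum_le_sum_abs _ _
      _ ≤ ∑ _i ∈ Finset.range k, (1 : ℝ) := Finset.sum_le_sum fun i _ =>
          (abs_of_nonneg (hq i ω).1).trans_le (hq i ω).2
      _ = k := by simp
  rw [Real.norm_of_nonneg (Real.exp_pos _).le, Real.exp_le_exp]
  calc logSupermartingale ξ p l k ω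
      ≤ |l * ∑ i ∈ Finset.range k, ξ i ω| + |(Real.exp l - 1) * ∑ i ∈ Finset.range k, p i ω| :=
        (le_abs_self _).trans (abs_sub _ _)
    _ ≤ |l| * k + |Real.exp l - 1| * k := by
        rw [abs_mul, abs_mul]
        gcongr
        exacts [hsum h.trial_mem, hsum h.probability_mem]

lemma integral_mul_exp_mul_one_add_le (h : IsBernoulliTrials P ℱ ξ p) (c : ℝ) (k : ℕ)
    {M : Ω → ℝ} (hM : Measurable[ℱ k] M) (hM_nonneg : ∀ ω, 0 ≤ M ω) (hM_int : Integrable M P) :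
    ∫ ω, M ω * Real.exp (-(c * p k ω)) * (1 + c * ξ k ω) ∂P ≤ ∫ ω, M ω ∂P := by
  set G : Ω → ℝ := fun ω => M ω * Real.exp (-(c * p k ω)) with hG_def
  have hexp : Measurable[ℱ k] fun ω => Real.exp (-(c * p k ω)) :=
    ((h.measurable_probability k).const_mul c).neg.exp
  have hG : Measurable[ℱ k] G := hM.mul hexp
  have hG_int : Integrable G P := hM_int.mul_bdd (c := Real.exp |c|)
    (hexp.mono (ℱ.le k) le_rfl).aestronglyMeasurable (ae_of_all _ fun ω => by
      rw [Real.norm_of_nonneg (Real.exp_pos _).le, Real.exp_le_exp]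
      refine (neg_le_abs _).trans ?_
      rw [abs_mul, abs_of_nonneg (h.probability_mem k ω).1]
      exact mul_le_of_le_one_right (abs_nonneg c) (h.probability_mem k ω).2)
  have hint {q : Ω → ℝ} (hq : Integrable q P) (hq_mem : ∀ ω, q ω ∈ Set.Icc 0 1) :
      Integrable (fun ω => c * (G ω * q ω)) P :=
    (hG_int.mul_bdd (c := 1) hq.aestronglyMeasurable (ae_of_all _ fun ω =>
      (Real.norm_of_nonneg (hq_mem ω).1).trans_le (hq_mem ω).2)).const_mul c
  have hGξ := hint (h.integrable_trial k) (h.trial_mem k)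
  have hGp := hint (h.integrable_probability k) (h.probability_mem k)
  calc ∫ ω, G ω * (1 + c * ξ k ω) ∂P
      = ∫ ω, (G ω + c * (G ω * ξ k ω)) ∂P := by congr with ω; ring
    _ = ∫ ω, (G ω + c * (G ω * p k ω)) ∂P := by
        rw [integral_add hG_int hGξ, integral_add hG_int hGp, integral_const_mul,
          integral_const_mul, h.integral_mul_trial k hG hG_int]
    _ ≤ ∫ ω, M ω ∂P := integral_mono (hG_int.add hGp) hM_int fun ω => by
        calc G ω + c * (G ω * p k ω)
            = M ω * Real.exp (-(c * p k ω)) * (c * p k ω + 1) := by rw [hG_def]; ring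
          _ ≤ M ω * Real.exp (-(c * p k ω)) * Real.exp (c * p k ω) :=
            mul_le_mul_of_nonneg_left (Real.add_one_le_exp _)
              (mul_nonneg (hM_nonneg ω) (Real.exp_pos _).le)
          _ = M ω := by rw [mul_assoc, ← Real.exp_add, neg_add_cancel, Real.exp_zero, mul_one]

lemma integral_exp_logSupermartingale_le_one (h : IsBernoulliTrials P ℱ ξ p) (l : ℝ) (k : ℕ) :
    ∫ ω, Real.exp (logSupermartingale ξ p l k ω) ∂P ≤ 1 := by
  induction k with
  | zero => simp [logSupermartingale]
  | succ k ih =>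
    simp only [h.exp_logSupermartingale_succ]
    exact (h.integral_mul_exp_mul_one_add_le _ k (h.measurable_logSupermartingale l k).exp
      (fun ω => (Real.exp_pos _).le) (h.integrable_exp_logSupermartingale l k)).trans ih

lemma integral_sum_add_sum (h : IsBernoulliTrials P ℱ ξ p) (a b : ℝ) (k : ℕ) :
    Integrable (fun ω => a * ∑ i ∈ Finset.range k, ξ i ω + b * ∑ i ∈ Finset.range k, p i ω) P ∧
      ∫ ω, (a * ∑ i ∈ Finset.range k, ξ i ω + b * ∑ i ∈ Finset.range k, p i ω) ∂P =
        (a + b) * ∑ i ∈ Finset.range k, ∫ ω, p i ω ∂P := by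
  have hξ := (integrable_finsetSum (Finset.range k) fun i _ => h.integrable_trial i).const_mul a
  have hp := (integrable_finsetSum (Finset.range k) fun i _ =>
    h.integrable_probability i).const_mul b
  refine ⟨hξ.add hp, ?_⟩
  rw [integral_add hξ hp, integral_const_mul, integral_const_mul,
    integral_finsetSum _ fun i _ => h.integrable_trial i,
    integral_finsetSum _ fun i _ => h.integrable_probability i, add_mul]
  simp only [h.integral_trial]

-- Markov's inequality for `exp Y` alone would only give `exp (-t)`. The nonnegative variable
-- `exp Y - 1 + B`, with `B ≥ -Y`, gains the factor `∑ i, ∫ p i`, which makes the bound summable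
-- over the cells of a partition.
lemma measureReal_le_logSupermartingale_le (h : IsBernoulliTrials P ℱ ξ p) (l : ℝ) (k : ℕ) {t : ℝ}
    (ht : 0 < t) :
    P.real {ω | t ≤ logSupermartingale ξ p l k ω} ≤
      (|l| + |Real.exp l - 1|) * (∑ i ∈ Finset.range k, ∫ ω, p i ω ∂P) / (Real.exp t - 1) := by
  set Y := logSupermartingale ξ p l k
  set B : Ω → ℝ := fun ω => |l| * ∑ i ∈ Finset.range k, ξ i ω +
    |Real.exp l - 1| * ∑ i ∈ Finset.range k, p i ω
  obtain ⟨hB_int, hB_mean⟩ := h.integral_sum_add_sum |l| |Real.exp l - 1| k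
  have hB_nonneg (ω) : 0 ≤ B ω :=
    add_nonneg (mul_nonneg (abs_nonneg _) (Finset.sum_nonneg fun i _ => (h.trial_mem i ω).1))
      (mul_nonneg (abs_nonneg _) (Finset.sum_nonneg fun i _ => (h.probability_mem i ω).1))
  have hB_ge (ω) : -Y ω ≤ B ω := h.neg_logSupermartingale_le l k ω
  have hY_int := h.integrable_exp_logSupermartingale l k
  have hexp_int : Integrable (fun ω => Real.exp (Y ω) - 1) P := hY_int.sub (integrable_const 1)
  have hexp_mean : ∫ ω, (Real.exp (Y ω) - 1) ∂P ≤ 0 := by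
    rw [integral_sub hY_int (integrable_const 1), integral_const, probReal_univ, one_smul]
    linarith [h.integral_exp_logSupermartingale_le_one l k]
  have hnonneg (ω) : 0 ≤ Real.exp (Y ω) - 1 + B ω := by
    linarith [Real.add_one_le_exp (Y ω), hB_ge ω]
  have hmono (ω) (hω : t ≤ Y ω) : Real.exp t - 1 ≤ Real.exp (Y ω) - 1 + B ω := by
    linarith [Real.exp_le_exp.mpr hω, hB_nonneg ω]
  have ht_pos : 0 < Real.exp t - 1 := by linarith [Real.add_one_lt_exp ht.ne']
  rw [le_div_iff₀' ht_pos]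
  calc (Real.exp t - 1) * P.real {ω | t ≤ Y ω}
      ≤ (Real.exp t - 1) * P.real {ω | Real.exp t - 1 ≤ Real.exp (Y ω) - 1 + B ω} :=
        mul_le_mul_of_nonneg_left (measureReal_mono hmono) ht_pos.le
    _ ≤ ∫ ω, (Real.exp (Y ω) - 1 + B ω) ∂P :=
        mul_meas_ge_le_integral_of_nonneg (ae_of_all _ hnonneg) (hexp_int.add hB_int) _
    _ = ∫ ω, (Real.exp (Y ω) - 1) ∂P + ∫ ω, B ω ∂P := integral_add hexp_int hB_int
    _ ≤ (|l| + |Real.exp l - 1|) * ∑ i ∈ Finset.range k, ∫ ω, p i ω ∂P := by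
        rw [← hB_mean]
        linarith

lemma measureReal_sq_mul_add_lt_mul_sub_le (h : IsBernoulliTrials P ℱ ξ p) {l : ℝ} (hl : |l| ≤ 1)
    (k : ℕ) {t : ℝ} (ht : 0 < t) :
    P.real {ω | l ^ 2 * ∑ i ∈ Finset.range k, p i ω + t <
        l * (∑ i ∈ Finset.range k, ξ i ω - ∑ i ∈ Finset.range k, p i ω)} ≤
      3 * (∑ i ∈ Finset.range k, ∫ ω, p i ω ∂P) / (Real.exp t - 1) := by
  have hexp : |Real.exp l - 1 - l| ≤ l ^ 2 := Real.abs_exp_sub_one_sub_id_le hl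
  have hexp_le : Real.exp l - 1 ≤ l + l ^ 2 := by linarith [le_abs_self (Real.exp l - 1 - l)]
  have hsum : |l| + |Real.exp l - 1| ≤ 3 := by
    have hsq : l ^ 2 ≤ 1 := (sq_le_one_iff_abs_le_one l).mpr hl
    have hle : |Real.exp l - 1| ≤ |Real.exp l - 1 - l| + |l| := by
      simpa using abs_add_le (Real.exp l - 1 - l) l
    linarith
  have ht_pos : 0 < Real.exp t - 1 := by linarith [Real.add_one_lt_exp ht.ne']
  have hp_mean : 0 ≤ ∑ i ∈ Finset.range k, ∫ ω, p i ω ∂P :=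
    Finset.sum_nonneg fun i _ => integral_nonneg fun ω => (h.probability_mem i ω).1
  refine (measureReal_mono fun ω hω => ?_).trans
    ((h.measureReal_le_logSupermartingale_le l k ht).trans (by gcongr))
  have hp_sum : 0 ≤ ∑ i ∈ Finset.range k, p i ω :=
    Finset.sum_nonneg fun i _ => (h.probability_mem i ω).1
  simp only [Set.mem_ofPred_eq, logSupermartingale] at hω ⊢
  linarith [mul_le_mul_of_nonneg_right hexp_le hp_sum]

lemma measureReal_div_add_mul_lt_abs_sub_le (h : IsBernoulliTrials P ℱ ξ p) {k : ℕ} (hk : 1 ≤ k)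
    (n : ℕ) {t : ℝ} (ht : 0 < t) :
    P.real {ω | (∑ i ∈ Finset.range n, p i ω) / k + k * t <
        |∑ i ∈ Finset.range n, ξ i ω - ∑ i ∈ Finset.range n, p i ω|} ≤
      6 * (∑ i ∈ Finset.range n, ∫ ω, p i ω ∂P) / (Real.exp t - 1) := by
  have hk_pos : (0 : ℝ) < k := by exact_mod_cast hk
  have hinv : |(k : ℝ)⁻¹| ≤ 1 := by
    rw [abs_of_pos (inv_pos.mpr hk_pos)]
    exact inv_le_one_of_one_le₀ (by exact_mod_cast hk)
  have hupper := h.measureReal_sq_mul_add_lt_mul_sub_le hinv n ht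
  have hlower := h.measureReal_sq_mul_add_lt_mul_sub_le ((abs_neg _).trans_le hinv) n ht
  refine (measureReal_mono fun ω hω => ?_).trans ((measureReal_union_le _ _).trans
    ((add_le_add hupper hlower).trans_eq (by ring)))
  simp only [Set.mem_ofPred_eq, Set.mem_union, lt_abs] at hω ⊢
  have hscale (a b : ℝ) : a / k + k * t < b ↔ (k : ℝ)⁻¹ ^ 2 * a + t < (k : ℝ)⁻¹ * b := by
    rw [← mul_lt_mul_iff_right₀ (inv_pos.mpr hk_pos)]
    congr! 1
    field_simp
  simpa only [hscale, neg_sq, neg_mul, mul_neg] using hω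

lemma measureReal_lt_sqrt_sub_sqrt_sq_le (h : IsBernoulliTrials P ℱ ξ p) {n : ℕ} (hn : 0 < n)
    {t : ℝ} (ht : 1 ≤ t) :
    P.real {ω | 9 * t < (√(∑ i ∈ Finset.range n, ξ i ω) - √(∑ i ∈ Finset.range n, p i ω)) ^ 2} ≤
      n * (6 * (∑ i ∈ Finset.range n, ∫ ω, p i ω ∂P) / (Real.exp t - 1)) := by
  have ht_pos : 0 < t := by linarith
  have hsum_le (ω) : ∑ i ∈ Finset.range n, p i ω ≤ n ^ 2 * t := by
    have hn_one : (1 : ℝ) ≤ n := by exact_mod_cast hn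
    calc ∑ i ∈ Finset.range n, p i ω ≤ ∑ _i ∈ Finset.range n, (1 : ℝ) :=
          Finset.sum_le_sum fun i _ => (h.probability_mem i ω).2
      _ = n * 1 := by simp
      _ ≤ n ^ 2 * t := by gcongr; exact le_self_pow₀ hn_one two_ne_zero
  have hsubset : {ω | 9 * t <
      (√(∑ i ∈ Finset.range n, ξ i ω) - √(∑ i ∈ Finset.range n, p i ω)) ^ 2} ⊆
      ⋃ k ∈ Finset.Icc 1 n, {ω | (∑ i ∈ Finset.range n, p i ω) / k + k * t <
        |∑ i ∈ Finset.range n, ξ i ω - ∑ i ∈ Finset.range n, p i ω|} := fun ω hω => by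
    simpa only [Set.mem_iUnion₂, exists_prop, Set.mem_ofPred_eq] using exists_nat_lt_abs_sub
      (Finset.sum_nonneg fun i _ => (h.trial_mem i ω).1)
      (Finset.sum_nonneg fun i _ => (h.probability_mem i ω).1) ht_pos hn (hsum_le ω) hω
  refine (measureReal_mono hsubset (measure_ne_top _ _)).trans
    ((measureReal_biUnion_finset_le _ _).trans ?_)
  calc _ ≤ ∑ _k ∈ Finset.Icc 1 n,
        6 * (∑ i ∈ Finset.range n, ∫ ω, p i ω ∂P) / (Real.exp t - 1) :=
        Finset.sum_le_sum fun k hk =>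
          h.measureReal_div_add_mul_lt_abs_sub_le (Finset.mem_Icc.mp hk).1 n ht_pos
    _ = _ := by simp

end IsBernoulliTrials
end BernoulliTrials

/-! ### Concentration along the chain -/

section Chain

variable {Ω : Type*} [MeasurableSpace Ω] {P : Measure Ω} {d : ℕ} {μ : Measure (Fin d → ℝ)}
  {s : Pair d → ℝ} {X : ℕ → Ω → Fin d → ℝ} {n : ℕ} {K₁ K₂ : Set (Fin d → ℝ)}

lemma setIntegral_indicator_prod (hK₂ : MeasurableSet K₂) (hK₂_subset : K₂ ⊆ unitCube d)
    (z : Fin d → ℝ) : ∫ y in unitCube d, (K₁ ×ˢ K₂).indicator s (z, y) ∂μ =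
      K₁.indicator (fun _ => (1 : ℝ)) z * ∫ y in K₂, s (z, y) ∂μ := by
  by_cases hz : z ∈ K₁
  · have hsection (y) : (K₁ ×ˢ K₂).indicator s (z, y) = K₂.indicator (fun y => s (z, y)) y := by
      by_cases hy : y ∈ K₂ <;> simp [hz, hy]
    simp only [hsection, setIntegral_indicator hK₂, Set.inter_eq_right.mpr hK₂_subset,
      Set.indicator_of_mem hz, one_mul]
  · have hsection (y) : (K₁ ×ˢ K₂).indicator s (z, y) = 0 :=
      Set.indicator_of_notMem (fun h => hz h.1) _
    simp only [hsection, integral_zero, Set.indicator_of_notMem hz, zero_mul]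

lemma IsSubdensity.setIntegral_indicator_mem (hs : IsSubdensity μ s) {K : Set (Pair d)}
    (z : Fin d → ℝ) :
    ∫ y in unitCube d, K.indicator s (z, y) ∂μ ∈ Set.Icc 0 1 := by
  have hnonneg (p) : 0 ≤ K.indicator s p := Set.indicator_nonneg (fun p _ => hs.nonneg p) p
  refine ⟨integral_nonneg fun y => hnonneg _, le_trans ?_ (hs.setIntegral_section_le_one z)⟩
  exact integral_mono_of_nonneg (ae_of_all _ fun y => hnonneg _) (hs.integrable_section z)
    (ae_of_all _ fun y => Set.indicator_le_self' (fun _ _ => hs.nonneg _) _)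

lemma measurable_setIntegral_occupation [IsFiniteMeasure (μ.restrict (unitCube d))]
    (hX : ∀ i, Measurable (X i)) {K : Set (Pair d)} (hK : MeasurableSet K) {f : Pair d → ℝ}
    (hf : Measurable f) (hint : ∀ x, Integrable f (occupation μ n x)) :
    Measurable fun ω => ∫ p in K, f p ∂occupation μ n fun i => X i ω := by
  simp only [setIntegral_occupation hK hf (hint _).integrableOn]
  exact Finset.measurable_sum _ fun i _ =>
    (hf.indicator hK).stronglyMeasurable.integral_prod_right'.measurable.comp (hX i)

namespace IsMarkovChain

/-- The natural filtration of the chain. -/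
def filtration (h : IsMarkovChain P μ s X) : Filtration ℕ ‹MeasurableSpace Ω› :=
  Filtration.natural X fun i => (h.measurable_chain i).stronglyMeasurable

lemma measurable_filtration (h : IsMarkovChain P μ s X) (i : ℕ) :
    Measurable[h.filtration i] (X i) :=
  (Filtration.stronglyAdapted_natural
    (fun i => (h.measurable_chain i).stronglyMeasurable) i).measurable

lemma condExp_indicator_prod [IsFiniteMeasure P] (h : IsMarkovChain P μ s X)
    (hK₁ : MeasurableSet K₁) (hK₂ : MeasurableSet K₂) (hK₂_subset : K₂ ⊆ unitCube d) (i : ℕ) :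
    P[fun ω => (K₁ ×ˢ K₂).indicator (fun _ => (1 : ℝ)) (X i ω, X (i + 1) ω) |
        h.filtration i]
      =ᵐ[P] fun ω => ∫ y in unitCube d, (K₁ ×ˢ K₂).indicator s (X i ω, y) ∂μ := by
  set F : Ω → ℝ := fun ω => K₁.indicator (fun _ => (1 : ℝ)) (X i ω)
  set G : Ω → ℝ := (X (i + 1) ⁻¹' K₂).indicator fun _ => (1 : ℝ)
  have hF : StronglyMeasurable[h.filtration i] F := ((measurable_const.indicator hK₁).comp
    (h.measurable_filtration i)).stronglyMeasurable
  have hG : Integrable G P :=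
    (integrable_const (1 : ℝ)).indicator (h.measurable_chain (i + 1) hK₂)
  have hFG : Integrable (F * G) P := hG.bdd_mul (c := 1)
    (hF.mono (h.filtration.le i)).aestronglyMeasurable
    (ae_of_all _ fun ω => (norm_indicator_le_norm_self _ _).trans (by simp))
  have hprod : (fun ω => (K₁ ×ˢ K₂).indicator (fun _ => (1 : ℝ)) (X i ω, X (i + 1) ω)) = F * G := by
    ext ω
    exact Set.indicator_prod_one
  rw [hprod]
  filter_upwards [condExp_mul_of_stronglyMeasurable_left hF hFG hG, h.markov i K₂ hK₂]
    with ω hpull hmarkov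
  rw [hpull, Pi.mul_apply, setIntegral_indicator_prod hK₂ hK₂_subset]
  exact congrArg (F ω * ·) hmarkov

variable [IsProbabilityMeasure P] [IsFiniteMeasure (μ.restrict (unitCube d))]

lemma isBernoulliTrials (h : IsMarkovChain P μ s X) (hK₁ : MeasurableSet K₁)
    (hK₂ : MeasurableSet K₂) (hK₂_subset : K₂ ⊆ unitCube d) :
    IsBernoulliTrials P h.filtration
      (fun i ω => (K₁ ×ˢ K₂).indicator (fun _ => (1 : ℝ)) (X i ω, X (i + 1) ω))
      (fun i ω => ∫ y in unitCube d, (K₁ ×ˢ K₂).indicator s (X i ω, y) ∂μ) where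
  eq_zero_or_one i ω := by
    classical
    rw [Set.indicator_apply]
    split_ifs <;> simp
  measurable_trial i := (measurable_const.indicator (hK₁.prod hK₂)).comp
    (((h.measurable_filtration i).mono (h.filtration.mono i.le_succ) le_rfl).prodMk
      (h.measurable_filtration (i + 1)))
  measurable_probability i := (h.measurable_density.indicator
    (hK₁.prod hK₂)).stronglyMeasurable.integral_prod_right'.measurable.comp
      (h.measurable_filtration i)
  probability_mem i ω := h.isSubdensity.setIntegral_indicator_mem (X i ω)
  condExp_eq := h.condExp_indicator_prod hK₁ hK₂ hK₂_subset

lemma measureReal_lt_sqrt_transitions_sub_sq_le (h : IsMarkovChain P μ s X) (hn : 0 < n)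
    {t : ℝ} (ht : 1 ≤ t) {j : ℕ} {K : Set (Pair d)} (hK : K ∈ dyadicCubes d j) :
    P.real {ω | 9 * t < (√((transitions n fun i => X i ω).real K) -
        √(∫ p in K, s p ∂occupation μ n fun i => X i ω)) ^ 2} ≤
      n * (6 * (∫ ω, (∫ p in K, s p ∂occupation μ n fun i => X i ω) ∂P) / (Real.exp t - 1)) := by
  obtain ⟨K₁, K₂, hK₁, hK₂, rfl⟩ := exists_eq_prod_of_mem_dyadicCubes hK
  have hK₂_subset : K₂ ⊆ unitCube d := ((Set.prod_subset_prod_iff'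
    (nonempty_of_mem_dyadicCubes hK)).mp (subset_unitSquare_of_mem_dyadicCubes hK)).2
  have htrials := h.isBernoulliTrials hK₁ hK₂ hK₂_subset
  have hbound := htrials.measureReal_lt_sqrt_sub_sqrt_sq_le hn ht
  rw [← integral_finsetSum _ fun i _ => htrials.integrable_probability i] at hbound
  simpa only [transitions_real (hK₁.prod hK₂), setIntegral_occupation (hK₁.prod hK₂)
    h.measurable_density h.isSubdensity.integrable_occupation.integrableOn] using hbound

lemma integrable_setIntegral_occupation (h : IsMarkovChain P μ s X) {K : Set (Pair d)}
    (hK : MeasurableSet K) :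
    Integrable (fun ω => ∫ p in K, s p ∂occupation μ n fun i => X i ω) P := by
  have hs := h.isSubdensity
  exact .of_mem_Icc 0 n (measurable_setIntegral_occupation h.measurable_chain hK
    h.measurable_density fun _ => hs.integrable_occupation).aemeasurable (ae_of_all _ fun ω =>
      ⟨setIntegral_nonneg hK fun p _ => hs.nonneg p, hs.setIntegral_occupation_le K⟩)

lemma sum_integral_setIntegral_occupation_le (h : IsMarkovChain P μ s X)
    {m : Finset (Set (Pair d))} (hm : IsDyadicPartition m) :
    ∑ K ∈ m, ∫ ω, (∫ p in K, s p ∂occupation μ n fun i => X i ω) ∂P ≤ n := by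
  have hs := h.isSubdensity
  rw [← integral_finsetSum _ fun K hK =>
    h.integrable_setIntegral_occupation (hm.measurableSet hK)]
  calc ∫ ω, ∑ K ∈ m, (∫ p in K, s p ∂occupation μ n fun i => X i ω) ∂P ≤ ∫ _ω, (n : ℝ) ∂P :=
        integral_mono (integrable_finsetSum _ fun K hK =>
          h.integrable_setIntegral_occupation (hm.measurableSet hK)) (integrable_const _)
          fun ω => (hm.sum_setIntegral hs.integrable_occupation).trans_le
            (hs.setIntegral_occupation_le _)
    _ = n := by simp

lemma measureReal_not_isGoodPath_le (h : IsMarkovChain P μ s X) (hn : 3 < n) :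
    P.real {ω | ¬IsGoodPath μ s n fun i => X i ω} ≤ 36 / n := by
  have hn' : (4 : ℝ) ≤ n := by exact_mod_cast hn
  have := Real.log_natCast_nonneg n
  have hexp : Real.exp (4 * Real.log n) = (n : ℝ) ^ 4 := by
    rw [mul_comm, Real.exp_mul, Real.exp_log (by positivity)]
    norm_cast
  have hpow : (1 : ℝ) ≤ (n : ℝ) ^ 4 / 2 := by
    have : (4 : ℝ) ^ 4 ≤ (n : ℝ) ^ 4 := by gcongr
    linarith
  have hcell {j : ℕ} {K : Set (Pair d)} (hK : K ∈ dyadicCubes d j) :=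
    h.measureReal_lt_sqrt_transitions_sub_sq_le (n := n) (t := 4 * Real.log n) (by omega)
      (by linarith [one_le_log_natCast hn]) hK
  have hlevel (j : ℕ) : ∑ K ∈ dyadicCubes d j, n * (6 * (∫ ω, (∫ p in K, s p
      ∂occupation μ n fun i => X i ω) ∂P) / (Real.exp (4 * Real.log n) - 1)) ≤
      n * (6 * n / (n ^ 4 / 2)) := by
    rw [← Finset.mul_sum, ← Finset.sum_div, ← Finset.mul_sum, hexp]
    gcongr
    · exact h.sum_integral_setIntegral_occupation_le (isDyadicPartition_dyadicCubes d j)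
    · linarith
  have hsubset : {ω | ¬IsGoodPath μ s n fun i => X i ω} ⊆
      ⋃ j ∈ Finset.range (2 * n + 1), ⋃ K ∈ dyadicCubes d j,
        {ω | 9 * (4 * Real.log n) < (√((transitions n fun i => X i ω).real K) -
          √(∫ p in K, s p ∂occupation μ n fun i => X i ω)) ^ 2} := fun ω hω => by
    simp only [IsGoodPath, IsConcentrated, Set.mem_ofPred_eq, not_forall, not_le] at hω
    obtain ⟨j, hj, K, hK, hlt⟩ := hω
    simp only [Set.mem_iUnion₂, Finset.mem_range, Set.mem_ofPred_eq, exists_prop]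
    exact ⟨j, by omega, K, hK, by linarith⟩
  calc P.real {ω | ¬IsGoodPath μ s n fun i => X i ω}
      ≤ ∑ _j ∈ Finset.range (2 * n + 1), n * (6 * n / ((n : ℝ) ^ 4 / 2)) :=
        (measureReal_mono hsubset (measure_ne_top _ _)).trans <|
          (measureReal_biUnion_finset_le _ _).trans <| Finset.sum_le_sum fun j _ =>
            (measureReal_biUnion_finset_le _ _).trans <|
              (Finset.sum_le_sum fun K hK => hcell hK).trans (hlevel j)
    _ ≤ (3 * n) * (n * (6 * n / ((n : ℝ) ^ 4 / 2))) := by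
        rw [Finset.sum_const, Finset.card_range, nsmul_eq_mul]
        gcongr
        push_cast
        linarith
    _ = 36 / n := by
        field_simp
        norm_num

end IsMarkovChain
end Chain

/-! ### The oracle inequality in expectation -/

lemma integral_le_integral_add_measureReal {Ω : Type*} [MeasurableSpace Ω] {P : Measure Ω}
    [IsFiniteMeasure P] {f g : Ω → ℝ} {B : Set Ω} (hf : Integrable f P) (hg : Integrable g P)
    (hfg : ∀ ω, f ω ≤ g ω + B.indicator (fun _ => 1) ω) :
    ∫ ω, f ω ∂P ≤ ∫ ω, g ω ∂P + P.real B := by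
  have hB := measurableSet_toMeasurable P B
  have hindicator : Integrable ((toMeasurable P B).indicator fun _ => (1 : ℝ)) P :=
    (integrable_const 1).indicator hB
  calc ∫ ω, f ω ∂P ≤ ∫ ω, (g ω + (toMeasurable P B).indicator (fun _ => (1 : ℝ)) ω) ∂P := by
        refine integral_mono hf (hg.add hindicator) fun ω => (hfg ω).trans (add_le_add le_rfl ?_)
        exact Set.indicator_le_indicator_of_subset (subset_toMeasurable P B)
          (fun _ => zero_le_one) ω
    _ = ∫ ω, g ω ∂P + P.real B := by
        rw [integral_add hg hindicator, integral_indicator_const _ hB, smul_eq_mul, mul_one,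
          measureReal_def, measureReal_def, measure_toMeasurable]

section Expectation

variable {Ω : Type*} [MeasurableSpace Ω] {P : Measure Ω} {d n : ℕ} {μ : Measure (Fin d → ℝ)}
  {s : Pair d → ℝ} {X : ℕ → Ω → Fin d → ℝ} {m : Finset (Set (Pair d))} {K : Set (Pair d)}
  {L : ℝ} {ℓ : ℕ∞} {mhat : Ω → Finset (Set (Pair d))}

lemma measurable_transitions_real (hX : ∀ i, Measurable (X i)) (hK : MeasurableSet K) :
    Measurable fun ω => (transitions n fun i => X i ω).real K := by
  simp only [transitions_real hK]
  exact Finset.measurable_sum _ fun i _ =>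
    (measurable_const.indicator hK).comp ((hX i).prodMk (hX (i + 1)))

variable [IsFiniteMeasure (μ.restrict (unitCube d))]

lemma measurable_occupation_real (hX : ∀ i, Measurable (X i)) (hK : MeasurableSet K) :
    Measurable fun ω => (occupation μ n fun i => X i ω).real K := by
  simpa using measurable_setIntegral_occupation (μ := μ) (n := n) hX hK
    (measurable_const (a := (1 : ℝ))) fun _ => integrable_const _

namespace IsSubdensity

lemma measurable_setIntegral_sqrt (hs : IsSubdensity μ s) (hX : ∀ i, Measurable (X i))
    (hK : MeasurableSet K) :
    Measurable fun ω => ∫ p in K, √(s p) ∂occupation μ n fun i => X i ω :=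
  measurable_setIntegral_occupation hX hK hs.measurable.sqrt fun _ =>
    integrable_sqrt hs.integrable_occupation

lemma measurable_cellLoss (hs : IsSubdensity μ s) (hX : ∀ i, Measurable (X i))
    (hK : MeasurableSet K) {a : Ω → ℝ} (ha : Measurable a) (ha_nonneg : ∀ ω, 0 ≤ a ω) :
    Measurable fun ω => cellLoss (occupation μ n fun i => X i ω) s K (a ω) := by
  simp only [cellLoss_eq hs.nonneg hs.integrable_occupation (ha_nonneg _)]
  exact ((measurable_setIntegral_occupation hX hK hs.measurable
    fun _ => hs.integrable_occupation).sub
      ((ha.sqrt.const_mul 2).mul (hs.measurable_setIntegral_sqrt hX hK))).add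
        (ha.mul (measurable_occupation_real hX hK))

lemma measurable_hellingerSq (hs : IsSubdensity μ s) (hX : ∀ i, Measurable (X i))
    (hm : IsDyadicPartition m) :
    Measurable fun ω => hellingerSq μ n (fun i => X i ω) ((unitSquare d).indicator s)
      (histogramEstimator μ n (fun i => X i ω) m) := by
  simp only [hellingerSq_histogramEstimator hs hm]
  exact (Finset.measurable_sum _ fun K hK => hs.measurable_cellLoss hX (hm.measurableSet hK)
    ((measurable_transitions_real hX (hm.measurableSet hK)).div
      (measurable_occupation_real hX (hm.measurableSet hK)))
    fun _ => cellRatio_nonneg).const_mul _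

lemma integrable_hellingerSqDist [IsFiniteMeasure P] (hs : IsSubdensity μ s)
    (hX : ∀ i, Measurable (X i)) (hm : IsDyadicPartition m) :
    Integrable (fun ω => hellingerSqDist μ n (fun i => X i ω) ((unitSquare d).indicator s)
      (histograms m)) P := by
  refine .of_mem_Icc 0 1 (Measurable.aemeasurable ?_) (ae_of_all _ fun ω =>
    ⟨hellingerSqDist_nonneg _ _, hellingerSqDist_histograms_le_one hs hm⟩)
  simp only [hellingerSqDist_histograms hs hm]
  exact (Finset.measurable_sum _ fun K hK => hs.measurable_cellLoss hX (hm.measurableSet hK)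
    (((hs.measurable_setIntegral_sqrt hX (hm.measurableSet hK)).div
      (measurable_occupation_real hX (hm.measurableSet hK))).pow_const 2)
    fun _ => sq_nonneg _).const_mul _

end IsSubdensity

namespace IsSelected

lemma integrable_hellingerSq [IsFiniteMeasure P] (hsel : IsSelected μ n L ℓ X mhat)
    (h : IsMarkovChain P μ s X) :
    Integrable (fun ω => hellingerSq μ n (fun i => X i ω) ((unitSquare d).indicator s)
      (histogramEstimator μ n (fun i => X i ω) (mhat ω))) P := by
  have hs := h.isSubdensity
  refine .of_mem_Icc 0 1 (Measurable.aemeasurable fun B hB => ?_) (ae_of_all _ fun ω =>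
    ⟨hellingerSq_nonneg _ _,
      hellingerSq_histogramEstimator_le_one hs (.of_mem_partitions (hsel.mem ω))⟩)
  have hpreimage : (fun ω => hellingerSq μ n (fun i => X i ω) ((unitSquare d).indicator s)
      (histogramEstimator μ n (fun i => X i ω) (mhat ω))) ⁻¹' B =
      ⋃ m ∈ partitions d ℓ, {ω | mhat ω = m} ∩
        (fun ω => hellingerSq μ n (fun i => X i ω) ((unitSquare d).indicator s)
          (histogramEstimator μ n (fun i => X i ω) m)) ⁻¹' B := by
    ext ω
    simp only [Set.mem_preimage, Set.mem_iUnion, Set.mem_inter_iff, Set.mem_ofPred_eq]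
    constructor
    · exact fun hω => ⟨mhat ω, hsel.mem ω, rfl, hω⟩
    · rintro ⟨m, -, rfl, hω⟩
      exact hω
  rw [hpreimage]
  exact .biUnion (countable_partitions d ℓ) fun m hm => (hsel.measurableSet_eq m hm).inter
    (hs.measurable_hellingerSq h.measurable_chain (.of_mem_partitions hm) hB)

lemma hellingerSq_le_add_indicator (hsel : IsSelected μ n L ℓ X mhat) (hs : IsSubdensity μ s)
    (hd : 0 < d) (hn : 3 < n) (hL : 6000 ≤ L) (hm : m ∈ partitions d ℓ) (hmn : m.card ≤ n)
    (ω : Ω) :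
    hellingerSq μ n (fun i => X i ω) ((unitSquare d).indicator s)
        (histogramEstimator μ n (fun i => X i ω) (mhat ω)) ≤
      1440 * (hellingerSqDist μ n (fun i => X i ω) ((unitSquare d).indicator s) (histograms m)
        + pen L n m) + {ω | ¬IsGoodPath μ s n fun i => X i ω}.indicator (fun _ => 1) ω := by
  by_cases hω : IsGoodPath μ s n fun i => X i ω
  · rw [Set.indicator_of_notMem (not_not_intro hω), add_zero]
    exact hω.hellingerSq_le hd hn hs hL hm hmn (hsel.mem ω) (hsel.criterion_le ω)
  · rw [Set.indicator_of_mem hω]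
    have hdist := hellingerSqDist_nonneg (μ := μ) (n := n) (x := fun i => X i ω)
      ((unitSquare d).indicator s) (histograms m)
    have hpen := pen_nonneg (n := n) (by linarith : 0 ≤ L) m
    linarith [hellingerSq_histogramEstimator_le_one (n := n) (x := fun i => X i ω) hs
      (.of_mem_partitions (hsel.mem ω))]

lemma integral_hellingerSq_le [IsProbabilityMeasure P] (hsel : IsSelected μ n L ℓ X mhat)
    (h : IsMarkovChain P μ s X) (hd : 0 < d) (hn : 3 < n) (hL : 6000 ≤ L)
    (hm : m ∈ partitions d ℓ) :
    ∫ ω, hellingerSq μ n (fun i => X i ω) ((unitSquare d).indicator s)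
        (histogramEstimator μ n (fun i => X i ω) (mhat ω)) ∂P ≤
      1441 * (∫ ω, hellingerSqDist μ n (fun i => X i ω) ((unitSquare d).indicator s)
        (histograms m) ∂P + pen L n m) := by
  have hs := h.isSubdensity
  have hpartition := IsDyadicPartition.of_mem_partitions hm
  have hdist_nonneg : 0 ≤ ∫ ω, hellingerSqDist μ n (fun i => X i ω) ((unitSquare d).indicator s)
      (histograms m) ∂P := integral_nonneg fun _ => hellingerSqDist_nonneg _ _
  rcases le_total m.card n with hmn | hmn
  · have hdist := hs.integrable_hellingerSqDist (P := P) (n := n) h.measurable_chain hpartition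
    have hmain := integral_le_integral_add_measureReal (hsel.integrable_hellingerSq h)
      ((hdist.add (integrable_const _)).const_mul 1440)
      (hsel.hellingerSq_le_add_indicator hs hd hn hL hm hmn)
    have hbad : P.real {ω | ¬IsGoodPath μ s n fun i => X i ω} ≤ pen L n m := by
      have hcard : (1 : ℝ) ≤ m.card := by exact_mod_cast hpartition.card_pos
      calc P.real {ω | ¬IsGoodPath μ s n fun i => X i ω} ≤ 36 / n :=
            h.measureReal_not_isGoodPath_le hn
        _ = 1 / n * (36 * 1 * 1) := by ring
        _ ≤ 1 / n * (36 * Real.log n * m.card) := by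
            gcongr
            exact one_le_log_natCast hn
        _ ≤ pen L n m := mul_log_mul_card_le_pen (by linarith) m
    simp only [Pi.add_apply, integral_const_mul, integral_add hdist (integrable_const _),
      integral_const, probReal_univ, one_smul] at hmain
    linarith
  · calc ∫ ω, hellingerSq μ n (fun i => X i ω) ((unitSquare d).indicator s)
          (histogramEstimator μ n (fun i => X i ω) (mhat ω)) ∂P
        ≤ ∫ _ω, (1 : ℝ) ∂P := integral_mono (hsel.integrable_hellingerSq h) (integrable_const _)
          fun ω => hellingerSq_histogramEstimator_le_one hs (.of_mem_partitions (hsel.mem ω))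
      _ = 1 := by simp
      _ ≤ _ := by linarith [le_pen_of_le_card hn (by linarith : 0 ≤ L) hmn]

end IsSelected

end Expectation

end TransitionDensity

end

open TransitionDensity in
theorem mainTheorem1_general {d n : ℕ} (hd : 0 < d) (hn : 3 < n) {μ : Measure (Fin d → ℝ)}
    (hμ : μ (unitCube d) < ⊤) {Ω : Type*} [MeasurableSpace Ω] {P : Measure Ω}
    [IsProbabilityMeasure P] {s : Pair d → ℝ} {X : ℕ → Ω → (Fin d → ℝ)}
    (hX : IsMarkovChain P μ s X) {L : ℝ} (hL : 6000 ≤ L) {ℓ : ℕ∞}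
    {mhat : Ω → Finset (Set (Pair d))} (hsel : IsSelected μ n L ℓ X mhat) :
    Integrable (fun ω => hellingerSq μ n (fun i => X i ω) ((unitSquare d).indicator s)
        (histogramEstimator μ n (fun i => X i ω) (mhat ω))) P ∧
      1 / 1441 * ∫ ω, hellingerSq μ n (fun i => X i ω) ((unitSquare d).indicator s)
          (histogramEstimator μ n (fun i => X i ω) (mhat ω)) ∂P ≤
        ⨅ m : partitions d ℓ, (∫ ω, hellingerSqDist μ n (fun i => X i ω)
          ((unitSquare d).indicator s) (histograms m.1) ∂P + pen L n m.1) := by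
  have : IsFiniteMeasure (μ.restrict (unitCube d)) := isFiniteMeasure_restrict.mpr hμ.ne
  have : Nonempty (partitions d ℓ) := ⟨⟨_, singleton_mem_partitions d ℓ⟩⟩
  refine ⟨hsel.integrable_hellingerSq hX, le_ciInf fun m => ?_⟩
  have := hsel.integral_hellingerSq_le hX hd hn hL m.2
  linarith

theorem mainTheorem1 :
    ∃ L₀ : ℝ, 0 < L₀ ∧ ∃ C : ℝ, 0 < C ∧
      ∀ (d n : ℕ), 0 < d → 3 < n →
      ∀ (μ : MeasureTheory.Measure (Fin d → ℝ)), μ (TransitionDensity.unitCube d) = 1 →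
      ∀ {Ω : Type*} [MeasurableSpace Ω] (P : MeasureTheory.Measure Ω)
        [MeasureTheory.IsProbabilityMeasure P]
        (s : TransitionDensity.Pair d → ℝ) (X : ℕ → Ω → (Fin d → ℝ)),
        TransitionDensity.IsMarkovChain P μ s X →
      ∀ (L : ℝ), L₀ ≤ L → ∀ (ℓ : ℕ∞), 1 ≤ ℓ →
      ∀ (mhat : Ω → Finset (Set (TransitionDensity.Pair d))),
        TransitionDensity.IsSelected μ n L ℓ X mhat →
      MeasureTheory.Integrable (fun ω =>
          TransitionDensity.hellingerSq μ n (fun i => X i ω)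
            ((TransitionDensity.unitSquare d).indicator s)
            (TransitionDensity.histogramEstimator μ n (fun i => X i ω) (mhat ω))) P ∧
      C * ∫ ω, TransitionDensity.hellingerSq μ n (fun i => X i ω)
            ((TransitionDensity.unitSquare d).indicator s)
            (TransitionDensity.histogramEstimator μ n (fun i => X i ω) (mhat ω)) ∂P
        ≤ ⨅ m : TransitionDensity.partitions d ℓ,
            ((∫ ω, TransitionDensity.hellingerSqDist μ n (fun i => X i ω)
                ((TransitionDensity.unitSquare d).indicator s)
                (TransitionDensity.histograms m.1) ∂P)
              + TransitionDensity.pen L n m.1) := by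
  refine ⟨6000, by norm_num, 1 / 1441, by norm_num, ?_⟩
  intro d n hd hn μ hμ Ω _ P _ s X hX L hL ℓ _ mhat hsel
  exact mainTheorem1_general hd hn (hμ.trans_lt ENNReal.one_lt_top) hX hL hsel
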